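/- **Conventions.** Operads are symmetric operads in sets with set of colours $\mathbb N$; morphisms of operads are the identity on colours. Let $\langle n\rangle$ be the linear order $0<1<\dots<n$ regarded as a category, with distinguished objects $0$ and $n$. For small categories, $A\,\square\,B$ denotes the funny tensor product (objects are pairs; morphisms are generated by morphisms in a single coordinate, subject only to functoriality in each coordinate), and $A\times B$ the cartesian product. $\mathrm{Cat}_{*,*}$ denotes functors that preserve the distinguished objects (all coordinates minimal, resp. maximal). * The *lattice path operad* $\mathcal L$ and the *paths operad* $\mathcal M$ are $$\mathcal L(n_1,\dots,n_k;n)=\mathrm{Cat}_{*,*}(\langle n+1\rangle,\langle n_1+1\rangle\square\cdots\square\langle n_k+1\rangle),\qquad \mathcal M(n_1,\dots,n_k;n)=\mathrm{Cat}_{*,*}(\langle n+1\rangle,\langle n_1+1\rangle\times\cdots\times\langle n_k+1\rangle),$$ $k\ge 0$, with substitution given by $\square$ (resp. $\times$) and composition of functors. The canonical functors $\square\to\times$ induce a morphism of operads $p:\mathcal L\to\mathcal M$. * For $\psi\in\mathcal L$ and $i\neq j$, let $c_{ij}(\psi)$ be the number of changes of direction of the projection of $\psi$ to the coordinates $i,j$.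 For $n\ge1$, $\mathcal L^{(n)}\subseteq\mathcal L$ is the suboperad of all $\psi$ with $c_{ij}(\psi)\le n$ for all $i\ne j$. * The *first movement order* $\varpi(\psi)$ is the linear order on the set of inputs of $\psi\in\mathcal L$ in which $i$ precedes $j$ iff $\psi$ moves in direction $i$ before it first moves in direction $j$. * For $\phi\in\mathcal M$, the support $\mathrm{supp}(\phi_i)$ is the set of generators $r\to r+1$ of $\langle n+1\rangle$ that the $i$-th component of $\phi$ does not send to an identity. A *shuffling of length $n$* of finite nonempty sets $A,B$ of generators consists of decompositions into nonempty blocks $A=A_1\cup\dots\cup A_s$, $A_1<\dots<A_s$, and $B=B_1\cup\dots\cup B_t$, $B_1<\dots<B_t$, with $s+t=n+1$, such that all blocks of both sets form one alternating chain, either $A_1\le B_1\le A_2\le B_2\le\cdots$ or $B_1\le A_1\le B_2\le A_2\le\cdots$. The *linking number* $\mathrm{lk}_{ij}(\phi)$ is the smallest length of a shuffling of $\mathrm{supp}(\phi_i)$ and $\mathrm{supp}(\phi_j)$. * Let $\mathcal M^{(0)}=\mathcal M\times\mathcal Ass$, where the operations of $\mathcal Ass$ are the linear orders on the set of inputs.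 For $n\ge1$ let $q^{(n)}:\mathcal M^{(0)}\to\mathcal M^{(n)}$ be the quotient by the smallest operadic congruence that identifies $(\phi,\sigma)$ with $(\phi,\sigma')$ for all operations $\phi\in \mathcal M$ with two inputs and $\mathrm{lk}_{12}(\phi)\le n$ and all orders $\sigma,\sigma'$; let $q^{(0)}=\mathrm{id}$. There are canonical morphisms $\mathcal M^{(n)}\to\mathcal M^{(n+1)}$ and $\mathcal M^{(n)}\to\mathcal M$. **Theorem.** 1. There are morphisms of operads $p^{(n)}:\mathcal L^{(n)}\to\mathcal M^{(n-1)}$, $n\ge1$, such that for all $n\ge 1$ the squares $$\begin{array}{ccc}\mathcal L^{(n)}&\to&\mathcal L^{(n+1)}\\ {\scriptstyle p^{(n)}}\downarrow&&\downarrow{\scriptstyle p^{(n+1)}}\\ \mathcal M^{(n-1)}&\to&\mathcal M^{(n)}\end{array}\qquad\qquad\begin{array}{ccc}\mathcal L^{(n)}&\to&\mathcal L\\ {\scriptstyle p^{(n)}}\downarrow&&\downarrow{\scriptstyle p}\\ \mathcal M^{(n-1)}&\to&\mathcal M\end{array}$$ commute, and $p^{(n)}(\psi)=q^{(n-1)}(p(\psi),\varpi(\psi))$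 for all $\psi\in\mathcal L^{(n)}$; in particular $p^{(1)}=(p,\varpi)$. 2. Let $\psi\in\mathcal L$, let $\chi=\psi(\omega_1,\dots,\omega_k)$ be a composite in $\mathcal L$, let $i\ne i'$ be inputs of $\psi$, and let $j$, $j'$ be inputs of $\omega_i$, $\omega_{i'}$; write $(i,j)$ and $(i',j')$ for the corresponding inputs of $\chi$. Suppose that $i$ precedes $i'$ in $\varpi(\psi)$ but $(i',j')$ precedes $(i,j)$ in $\varpi(\chi)$. Then $c_{(i,j)(i',j')}(\chi)<c_{ii'}(\psi)$ and $\mathrm{lk}_{(i,j)(i',j')}(p(\chi))<c_{ii'}(\psi)$. If moreover the supports of $p(\psi)_i$ and $p(\psi)_{i'}$ are disjoint (for instance, if $\psi$ is a shuffle path), then $\mathrm{lk}_{(i,j)(i',j')}(p(\chi))<\mathrm{lk}_{ii'}(p(\psi))$. -/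

import Mathlib

namespace LatticePath

/-! ### Coloured symmetric operads in sets -/

/-- A symmetric operad in sets with set of colours `C`, indexed by finite sets.
`Op c d` is the set of operations with inputs `c i`, `i : I`, and output `d`; for `I = Fin k` this
is `O(c 0, …, c (k - 1); d)`, and `relabel` is then the (right) action of the symmetric group. -/
structure Operad (C : Type) where
  Op : ∀ {I : Type} [Finite I], (I → C) → C → Type
  one : ∀ d : C, Op (fun _ : Unit => d) d
  comp : ∀ {I : Type} [Finite I] {J : I → Type} [∀ i, Finite (J i)] {c : I → C}
    {e : ∀ i, J i → C} {d : C}, Op c d → (∀ i, Op (e i) (c i)) →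
      Op (fun q : Σ i, J i => e q.1 q.2) d
  relabel : ∀ {I J : Type} [Finite I] [Finite J] (s : J ≃ I) {c : I → C} {d : C},
    Op c d → Op (fun j => c (s j)) d
  relabel_refl : ∀ {I : Type} [Finite I] {c : I → C} {d : C} (x : Op c d),
    relabel (Equiv.refl I) x = x
  relabel_trans : ∀ {I J K : Type} [Finite I] [Finite J] [Finite K] (s : J ≃ I) (t : K ≃ J)
    {c : I → C} {d : C} (x : Op c d), relabel t (relabel s x) = relabel (t.trans s) x
  comp_relabel_left : ∀ {I I' : Type} [Finite I] [Finite I'] (s : I' ≃ I) {J : I → Type}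
    [∀ i, Finite (J i)] {c : I → C} {e : ∀ i, J i → C} {d : C}
    (x : Op c d) (y : ∀ i, Op (e i) (c i)),
    comp (relabel s x) (fun i => y (s i)) = relabel (Equiv.sigmaCongrLeft s) (comp x y)
  comp_relabel_right : ∀ {I : Type} [Finite I] {J J' : I → Type} [∀ i, Finite (J i)]
    [∀ i, Finite (J' i)] (t : ∀ i, J' i ≃ J i) {c : I → C} {e : ∀ i, J i → C} {d : C}
    (x : Op c d) (y : ∀ i, Op (e i) (c i)),
    comp x (fun i => relabel (t i) (y i)) = relabel (Equiv.sigmaCongrRight t) (comp x y)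
  one_comp : ∀ {I : Type} [Finite I] {c : I → C} {d : C} (x : Op c d),
    comp (one d) (fun _ => x) = relabel (Equiv.uniqueSigma fun _ : Unit => I) x
  comp_one : ∀ {I : Type} [Finite I] {c : I → C} {d : C} (x : Op c d),
    comp x (fun i => one (c i)) = relabel (Equiv.sigmaUnique I fun _ => Unit) x
  assoc : ∀ {I : Type} [Finite I] {J : I → Type} [∀ i, Finite (J i)] {K : ∀ i, J i → Type}
    [∀ i j, Finite (K i j)] {c : I → C} {e : ∀ i, J i → C} {f : ∀ i j, K i j → C} {d : C}
    (x : Op c d) (y : ∀ i, Op (e i) (c i)) (z : ∀ i j, Op (f i j) (e i j)),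
    comp (comp x y) (fun q => z q.1 q.2) =
      relabel (Equiv.sigmaAssoc K) (comp x (fun i => comp (y i) (z i)))

namespace Operad

variable {C : Type}

/-- Morphisms of operads with the same set of colours, the identity on colours. -/
@[ext]
structure Hom (O P : Operad C) where
  app : ∀ {I : Type} [Finite I] {c : I → C} {d : C}, O.Op c d → P.Op c d
  app_one : ∀ d, app (O.one d) = P.one d
  app_comp : ∀ {I : Type} [Finite I] {J : I → Type} [∀ i, Finite (J i)] {c : I → C}
    {e : ∀ i, J i → C} {d : C} (x : O.Op c d) (y : ∀ i, O.Op (e i) (c i)),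
    app (O.comp x y) = P.comp (app x) (fun i => app (y i))
  app_relabel : ∀ {I J : Type} [Finite I] [Finite J] (s : J ≃ I) {c : I → C} {d : C}
    (x : O.Op c d), app (O.relabel s x) = P.relabel s (app x)

/-- The identity morphism. -/
def Hom.id (O : Operad C) : Hom O O where
  app x := x
  app_one _ := rfl
  app_comp _ _ := rfl
  app_relabel _ _ _ _ := rfl

/-- Composition of morphisms, in diagrammatic order. -/
def Hom.trans {O P Q : Operad C} (f : Hom O P) (g : Hom P Q) : Hom O Q where
  app x := g.app (f.app x)
  app_one d := by rw [f.app_one, g.app_one]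
  app_comp x y := by rw [f.app_comp, g.app_comp]
  app_relabel s _ _ x := by rw [f.app_relabel, g.app_relabel]

/-- The suboperad of the operations that satisfy `P`. -/
def sub (O : Operad C) (P : ∀ {I : Type} [Finite I] {c : I → C} {d : C}, O.Op c d → Prop)
    (hone : ∀ d, P (O.one d))
    (hcomp : ∀ {I : Type} [Finite I] {J : I → Type} [∀ i, Finite (J i)] {c : I → C}
      {e : ∀ i, J i → C} {d : C} (x : O.Op c d) (y : ∀ i, O.Op (e i) (c i)),
      P x → (∀ i, P (y i)) → P (O.comp x y))
    (hrel : ∀ {I J : Type} [Finite I] [Finite J] (s : J ≃ I) {c : I → C} {d : C}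
      (x : O.Op c d), P x → P (O.relabel s x)) : Operad C where
  Op c d := {x : O.Op c d // P x}
  one d := ⟨O.one d, hone d⟩
  comp x y := ⟨O.comp x.1 fun i => (y i).1, hcomp _ _ x.2 fun i => (y i).2⟩
  relabel s _ _ x := ⟨O.relabel s x.1, hrel s x.1 x.2⟩
  relabel_refl x := Subtype.ext (O.relabel_refl x.1)
  relabel_trans s t _ _ x := Subtype.ext (O.relabel_trans s t x.1)
  comp_relabel_left s _ _ _ _ _ x y := Subtype.ext (O.comp_relabel_left s x.1 fun i => (y i).1)
  comp_relabel_right t _ _ _ x y := Subtype.ext (O.comp_relabel_right t x.1 fun i => (y i).1)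
  one_comp x := Subtype.ext (O.one_comp x.1)
  comp_one x := Subtype.ext (O.comp_one x.1)
  assoc x y z := Subtype.ext (O.assoc x.1 (fun i => (y i).1) fun i j => (z i j).1)

/-- The product of two operads with the same colours. -/
def prod (O P : Operad C) : Operad C where
  Op c d := O.Op c d × P.Op c d
  one d := (O.one d, P.one d)
  comp x y := (O.comp x.1 fun i => (y i).1, P.comp x.2 fun i => (y i).2)
  relabel s _ _ x := (O.relabel s x.1, P.relabel s x.2)
  relabel_refl x := Prod.ext (O.relabel_refl x.1) (P.relabel_refl x.2)
  relabel_trans s t _ _ x := Prod.ext (O.relabel_trans s t x.1) (P.relabel_trans s t x.2)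
  comp_relabel_left s _ _ _ _ _ x y := Prod.ext
    (O.comp_relabel_left s x.1 fun i => (y i).1) (P.comp_relabel_left s x.2 fun i => (y i).2)
  comp_relabel_right t _ _ _ x y := Prod.ext
    (O.comp_relabel_right t x.1 fun i => (y i).1) (P.comp_relabel_right t x.2 fun i => (y i).2)
  one_comp x := Prod.ext (O.one_comp x.1) (P.one_comp x.2)
  comp_one x := Prod.ext (O.comp_one x.1) (P.comp_one x.2)
  assoc x y z := Prod.ext (O.assoc x.1 (fun i => (y i).1) fun i j => (z i j).1)
    (P.assoc x.2 (fun i => (y i).2) fun i j => (z i j).2)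

/-- The first projection of a product. -/
def prodFst (O P : Operad C) : Hom (O.prod P) O where
  app x := x.1
  app_one _ := rfl
  app_comp _ _ := rfl
  app_relabel _ _ _ _ := rfl

/-- A family of relations on the sets of operations of `O`. -/
abbrev Rel (O : Operad C) : Type 1 :=
  ∀ (I : Type) [Finite I] (c : I → C) (d : C), O.Op c d → O.Op c d → Prop

/-- The smallest equivalence relation on the operations of `O` that contains `r` and is compatible
with relabelling and substitution. -/
inductive Generated (O : Operad C) (r : O.Rel) :
    ∀ {I : Type} [Finite I] {c : I → C} {d : C}, O.Op c d → O.Op c d → Prop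
  | of {I : Type} [Finite I] {c : I → C} {d : C} {x x' : O.Op c d} :
      r I c d x x' → Generated O r x x'
  | refl {I : Type} [Finite I] {c : I → C} {d : C} (x : O.Op c d) : Generated O r x x
  | symm {I : Type} [Finite I] {c : I → C} {d : C} {x x' : O.Op c d} :
      Generated O r x x' → Generated O r x' x
  | trans {I : Type} [Finite I] {c : I → C} {d : C} {x x' x'' : O.Op c d} :
      Generated O r x x' → Generated O r x' x'' → Generated O r x x''
  | relabel {I J : Type} [Finite I] [Finite J] (s : J ≃ I) {c : I → C} {d : C}
      {x x' : O.Op c d} : Generated O r x x' → Generated O r (O.relabel s x) (O.relabel s x')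
  | comp {I : Type} [Finite I] {J : I → Type} [∀ i, Finite (J i)] {c : I → C}
      {e : ∀ i, J i → C} {d : C} {x x' : O.Op c d} {y y' : ∀ i, O.Op (e i) (c i)} :
      Generated O r x x' → (∀ i, Generated O r (y i) (y' i)) →
        Generated O r (O.comp x y) (O.comp x' y')

variable (O : Operad C) (r : O.Rel)

/-- `Generated O r` as a setoid on each set of operations. -/
def generatedSetoid {I : Type} [Finite I] (c : I → C) (d : C) : Setoid (O.Op c d) where
  r := Generated O r
  iseqv := ⟨.refl, .symm, .trans⟩

theorem Generated.out {I : Type} [Finite I] {c : I → C} {d : C} (x : O.Op c d) :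
    Generated O r (Quotient.mk (generatedSetoid O r c d) x).out x :=
  Quotient.mk_out (s := generatedSetoid O r c d) x

/-- The quotient of `O` by the operadic congruence generated by `r`. -/
noncomputable def quot : Operad C where
  Op c d := Quotient (generatedSetoid O r c d)
  one d := Quotient.mk _ (O.one d)
  comp x y := Quotient.mk _ (O.comp x.out fun i => (y i).out)
  relabel s _ _ x := Quotient.map (O.relabel s) (fun _ _ h => Generated.relabel s h) x
  relabel_refl x := by
    induction x using Quotient.inductionOn with
    | h x => exact congrArg (Quotient.mk _) (O.relabel_refl x)
  relabel_trans s t _ _ x := by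
    induction x using Quotient.inductionOn with
    | h x => exact congrArg (Quotient.mk _) (O.relabel_trans s t x)
  comp_relabel_left s _ _ _ _ _ x y := by
    have key := O.comp_relabel_left s x.out fun i => (y i).out
    have : (Quotient.mk _ (O.relabel (Equiv.sigmaCongrLeft s) (O.comp x.out fun i => (y i).out)) :
      Quotient (generatedSetoid O r _ _)) = _ := congrArg (Quotient.mk _) key.symm
    refine Eq.trans (Quotient.sound ?_) this.symm
    refine Generated.comp ?_ fun i => .refl _
    have h1 := Generated.out O r (O.relabel s x.out)
    convert h1 using 2
    conv_lhs => rw [← Quotient.out_eq x]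
    rfl
  comp_relabel_right t _ _ _ x y := by
    have key := O.comp_relabel_right t x.out fun i => (y i).out
    refine Eq.trans (Quotient.sound ?_) (congrArg (Quotient.mk _) key)
    refine Generated.comp (.refl _) fun i => ?_
    have h1 := Generated.out O r (O.relabel (t i) (y i).out)
    convert h1 using 2
    beta_reduce
    conv_lhs => rw [← Quotient.out_eq (y i)]
    rfl
  one_comp x := by
    have key := O.one_comp x.out
    refine Eq.trans (Quotient.sound (Generated.comp (.out O r _) fun i => .refl _)) ?_
    refine (congrArg (Quotient.mk _) key).trans ?_
    conv_rhs => rw [← Quotient.out_eq x]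
    rfl
  comp_one x := by
    have key := O.comp_one x.out
    refine Eq.trans (Quotient.sound (Generated.comp (.refl _) fun i => .out O r _)) ?_
    refine (congrArg (Quotient.mk _) key).trans ?_
    conv_rhs => rw [← Quotient.out_eq x]
    rfl
  assoc x y z := by
    have key := O.assoc x.out (fun i => (y i).out) fun i j => (z i j).out
    refine Eq.trans (Quotient.sound (Generated.comp (.out O r _) fun i => .refl _)) ?_
    refine (congrArg (Quotient.mk _) key).trans ?_
    exact Quotient.sound (Generated.relabel _ (Generated.comp (.refl _) fun i =>
      .symm (.out O r _)))

/-- The quotient morphism. -/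
noncomputable def quotMk : Hom O (O.quot r) where
  app x := Quotient.mk _ x
  app_one _ := rfl
  app_comp _ _ := Quotient.sound
    (Generated.comp (.symm (.out O r _)) fun _ => .symm (.out O r _))
  app_relabel _ _ _ _ := rfl

variable {O r} in
/-- A morphism out of `O` that identifies operations related by `r` identifies those related by the
generated congruence. -/
theorem Generated.app_eq {P : Operad C} (f : Hom O P)
    (hf : ∀ {I : Type} [Finite I] {c : I → C} {d : C} (x x' : O.Op c d), r I c d x x' →
      f.app x = f.app x')
    {I : Type} [Finite I] {c : I → C} {d : C} {x x' : O.Op c d} (h : Generated O r x x') :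
    f.app x = f.app x' := by
  induction h with
  | of h => exact hf _ _ h
  | refl => rfl
  | symm _ ih => exact ih.symm
  | trans _ _ ih ih' => exact ih.trans ih'
  | relabel s _ ih => rw [f.app_relabel, f.app_relabel, ih]
  | comp _ _ ih ih' =>
    rw [f.app_comp, f.app_comp, ih]
    congr 1
    funext i
    exact ih' i

/-- The morphism out of the quotient induced by a morphism that identifies operations related
by `r`. -/
noncomputable def quotLift {P : Operad C} (f : Hom O P)
    (hf : ∀ {I : Type} [Finite I] {c : I → C} {d : C} (x x' : O.Op c d), r I c d x x' →
      f.app x = f.app x') : Hom (O.quot r) P where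
  app x := Quotient.lift (s := generatedSetoid O r _ _) f.app (fun _ _ h => h.app_eq f hf) x
  app_one d := f.app_one d
  app_comp x y := by
    refine (f.app_comp _ _).trans ?_
    have hx : ∀ {I : Type} [Finite I] {c : I → C} {d : C} (x : (O.quot r).Op c d),
        f.app (Quotient.out x) =
          Quotient.lift (s := generatedSetoid O r _ _) f.app (fun _ _ h => h.app_eq f hf) x := by
      intro I _ c d x
      conv_rhs => rw [← Quotient.out_eq x]
      rfl
    rw [hx]
    congr 1
    funext i
    exact hx _
  app_relabel s _ _ x := by
    induction x using Quotient.inductionOn with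
    | h x => exact f.app_relabel s x

end Operad

open CategoryTheory

/-! ### The funny tensor product of categories -/

section Funny

variable {I : Type}

/-- The vertices of the graph that generates the funny tensor product. -/
@[ext]
structure FunnyVertex (A : I → Type) where
  pt : ∀ i, A i

/-- The generating arrows: a morphism in one coordinate, all other coordinates being fixed. -/
inductive FunnyStep {A : I → Type} [∀ i, SmallCategory (A i)] (a b : FunnyVertex A) : Type
  | mk (i : I) (f : a.pt i ⟶ b.pt i) (h : ∀ j, j ≠ i → a.pt j = b.pt j)

instance (A : I → Type) [∀ i, SmallCategory (A i)] : Quiver (FunnyVertex A) where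
  Hom a b := FunnyStep a b

/-- A generating arrow as a path of length one. -/
def FunnyStep.path {A : I → Type} [∀ i, SmallCategory (A i)] {a b : FunnyVertex A} (i : I)
    (f : a.pt i ⟶ b.pt i) (h : ∀ j, j ≠ i → a.pt j = b.pt j) :
    (Paths.of (FunnyVertex A)).obj a ⟶ (Paths.of (FunnyVertex A)).obj b :=
  (Paths.of (FunnyVertex A)).map (FunnyStep.mk i f h)

/-- The relations of the funny tensor product: functoriality in each coordinate. -/
inductive FunnyRel (A : I → Type) [∀ i, SmallCategory (A i)] :
    ∀ ⦃a b : Paths (FunnyVertex A)⦄, (a ⟶ b) → (a ⟶ b) → Prop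
  | id (a : FunnyVertex A) (i : I) :
      FunnyRel A (FunnyStep.path i (𝟙 (a.pt i)) fun _ _ => rfl) (𝟙 ((Paths.of _).obj a))
  | comp (a b c : FunnyVertex A) (i : I) (f : a.pt i ⟶ b.pt i) (g : b.pt i ⟶ c.pt i)
      (hf : ∀ j, j ≠ i → a.pt j = b.pt j) (hg : ∀ j, j ≠ i → b.pt j = c.pt j) :
      FunnyRel A (FunnyStep.path i f hf ≫ FunnyStep.path i g hg)
        (FunnyStep.path i (f ≫ g) fun j hj => (hf j hj).trans (hg j hj))

/-- The relations of the funny tensor product, as a relation on the path category. -/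
def funnyRel (A : I → Type) [∀ i, SmallCategory (A i)] : HomRel (Paths (FunnyVertex A)) :=
  fun _ _ p q => FunnyRel A p q

/-- The funny tensor product `□ i, A i` of a family of small categories: its objects are families
of objects, its morphisms are generated by the morphisms of the single `A i`, subject only to
functoriality in each coordinate. -/
@[ext]
structure Funny (A : I → Type) where
  mk ::
  pt : ∀ i, A i

namespace Funny

variable {A : I → Type} [∀ i, SmallCategory (A i)]

/-- An object as an object of the quotient of the path category. -/
def vertex (x : Funny A) : CategoryTheory.Quotient (funnyRel A) :=
  (CategoryTheory.Quotient.functor (funnyRel A)).obj (FunnyVertex.mk x.pt)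

instance : SmallCategory (Funny A) where
  Hom x y := x.vertex ⟶ y.vertex
  id x := 𝟙 x.vertex
  comp {x y z} f g := CategoryStruct.comp (X := x.vertex) (Y := y.vertex) (Z := z.vertex) f g

theorem ext' {x y : Funny A} (h : ∀ i, x.pt i = y.pt i) : x = y := Funny.ext (funext h)

/-- A morphism in the coordinate `i`. -/
def step {x y : Funny A} (i : I) (f : x.pt i ⟶ y.pt i) (h : ∀ j, j ≠ i → x.pt j = y.pt j) :
    x ⟶ y :=
  (CategoryTheory.Quotient.functor (funnyRel A)).map
    (FunnyStep.path (a := FunnyVertex.mk x.pt) (b := FunnyVertex.mk y.pt) i f h)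

theorem step_id (x : Funny A) (i : I) : step i (𝟙 (x.pt i)) (fun _ _ => rfl) = 𝟙 x :=
  CategoryTheory.Quotient.sound (funnyRel A) (FunnyRel.id (FunnyVertex.mk x.pt) i)

theorem step_comp {x y z : Funny A} (i : I) (f : x.pt i ⟶ y.pt i) (g : y.pt i ⟶ z.pt i)
    (hf : ∀ j, j ≠ i → x.pt j = y.pt j) (hg : ∀ j, j ≠ i → y.pt j = z.pt j) :
    step i f hf ≫ step i g hg = step i (f ≫ g) (fun j hj => (hf j hj).trans (hg j hj)) :=
  CategoryTheory.Quotient.sound (funnyRel A) (FunnyRel.comp (FunnyVertex.mk x.pt) (FunnyVertex.mk y.pt)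
    (FunnyVertex.mk z.pt) i f g hf hg)

theorem ext_of_step {x y : Funny A} (i : I) (e : x.pt i = y.pt i)
    (h : ∀ j, j ≠ i → x.pt j = y.pt j) (j : I) : x.pt j = y.pt j := by
  by_cases hj : j = i
  · subst hj; exact e
  · exact h j hj

theorem step_eqToHom {x y : Funny A} (i : I) (f : x.pt i ⟶ y.pt i)
    (h : ∀ j, j ≠ i → x.pt j = y.pt j) (e : x.pt i = y.pt i) (hf : f = eqToHom e) :
    step i f h = eqToHom (ext' (ext_of_step i e h)) := by
  have hxy : x = y := ext' (ext_of_step i e h)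
  subst hxy
  subst hf
  exact step_id x i

/-- Induction over the morphisms of the funny tensor product. -/
theorem hom_induction (P : ∀ {x y : Funny A}, (x ⟶ y) → Prop) (hid : ∀ x : Funny A, P (𝟙 x))
    (hcomp : ∀ {x y z : Funny A} (f : x ⟶ y) (g : y ⟶ z), P f → P g → P (f ≫ g))
    (hstep : ∀ {x y : Funny A} (i : I) (f : x.pt i ⟶ y.pt i) (h : ∀ j, j ≠ i → x.pt j = y.pt j),
      P (step i f h)) {x y : Funny A} (f : x ⟶ y) : P f := by
  refine CategoryTheory.Quotient.induction (funnyRel A)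
    (P := fun {a b} f => P (x := mk (FunnyVertex.pt a.as)) (y := mk (FunnyVertex.pt b.as)) f) ?_ f
  intro a b p
  refine Paths.induction (fun {a b} p => P (x := mk (FunnyVertex.pt a)) (y := mk (FunnyVertex.pt b))
    ((CategoryTheory.Quotient.functor (funnyRel A)).map p)) ?_ ?_ p
  · intro v
    exact hid _
  · intro u v w p q hp
    refine hcomp (x := mk (FunnyVertex.pt u)) (y := mk (FunnyVertex.pt v))
      (z := mk (FunnyVertex.pt w)) ((CategoryTheory.Quotient.functor (funnyRel A)).map p)
      ((CategoryTheory.Quotient.functor (funnyRel A)).map ((Paths.of _).map q)) hp ?_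
    obtain ⟨i, f, h⟩ := q
    exact hstep (x := mk (FunnyVertex.pt v)) (y := mk (FunnyVertex.pt w)) i f h

/-- Functors out of the funny tensor product. -/
def lift {D : Type*} [Category* D] (obj : Funny A → D)
    (map : ∀ {x y : Funny A} (i : I) (_ : x.pt i ⟶ y.pt i) (_ : ∀ j, j ≠ i → x.pt j = y.pt j),
      obj x ⟶ obj y)
    (hid : ∀ (x : Funny A) (i : I), map i (𝟙 (x.pt i)) (fun _ _ => rfl) = 𝟙 (obj x))
    (hcomp : ∀ (x y z : Funny A) (i : I) (f : x.pt i ⟶ y.pt i) (g : y.pt i ⟶ z.pt i)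
      (hf : ∀ j, j ≠ i → x.pt j = y.pt j) (hg : ∀ j, j ≠ i → y.pt j = z.pt j),
      map i f hf ≫ map i g hg = map i (f ≫ g) (fun j hj => (hf j hj).trans (hg j hj))) :
    Funny A ⥤ D :=
  let F : CategoryTheory.Quotient (funnyRel A) ⥤ D := CategoryTheory.Quotient.lift (funnyRel A)
    (Paths.lift
      { obj := fun a => obj (mk (FunnyVertex.pt a))
        map := fun {a b} s => match s with
          | FunnyStep.mk i f h => map (x := mk a.pt) (y := mk b.pt) i f h })
    (by
      intro a b p q hpq
      cases hpq with
      | id a i => exact (Category.id_comp _).trans (hid (mk a.pt) i)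
      | comp a b c i f g hf hg =>
        refine ((Paths.lift _).map_comp _ _).trans ?_
        refine Eq.trans (congrArg₂ _ (Category.id_comp _) (Category.id_comp _)) ?_
        exact (hcomp (mk a.pt) (mk b.pt) (mk c.pt) i f g hf hg).trans
          (Category.id_comp _).symm)
  { obj := obj
    map := fun {x y} f => F.map (X := x.vertex) (Y := y.vertex) f
    map_id := fun x => F.map_id x.vertex
    map_comp := fun {x y z} f g => F.map_comp (X := x.vertex) (Y := y.vertex) (Z := z.vertex) f g }

section lift

variable {D : Type*} [Category* D] {obj : Funny A → D}
    {map : ∀ {x y : Funny A} (i : I) (_ : x.pt i ⟶ y.pt i) (_ : ∀ j, j ≠ i → x.pt j = y.pt j),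
      obj x ⟶ obj y}
    (hid : ∀ (x : Funny A) (i : I), map i (𝟙 (x.pt i)) (fun _ _ => rfl) = 𝟙 (obj x))
    (hcomp : ∀ (x y z : Funny A) (i : I) (f : x.pt i ⟶ y.pt i) (g : y.pt i ⟶ z.pt i)
      (hf : ∀ j, j ≠ i → x.pt j = y.pt j) (hg : ∀ j, j ≠ i → y.pt j = z.pt j),
      map i f hf ≫ map i g hg = map i (f ≫ g) (fun j hj => (hf j hj).trans (hg j hj)))

@[simp] theorem lift_obj (x : Funny A) : (lift obj map hid hcomp).obj x = obj x := rfl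

@[simp] theorem lift_step {x y : Funny A} (i : I) (f : x.pt i ⟶ y.pt i)
    (h : ∀ j, j ≠ i → x.pt j = y.pt j) :
    (lift obj map hid hcomp).map (step i f h) = map i f h :=
  Category.id_comp _

end lift

/-- Transport of a morphism along an equality of coordinates. -/
def castHom {x y : ∀ i, A i} {i j : I} (e : j = i) (f : x i ⟶ y i) : x j ⟶ y j := by
  subst e
  exact f

@[simp] theorem castHom_rfl {x y : ∀ i, A i} {i : I} (e : i = i) (f : x i ⟶ y i) :
    castHom e f = f := rfl

@[simp] theorem castHom_id {x : ∀ i, A i} {i j : I} (e : j = i) :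
    castHom e (𝟙 (x i)) = 𝟙 (x j) := by
  subst e
  rfl

@[simp] theorem castHom_comp {x y z : ∀ i, A i} {i j : I} (e : j = i) (f : x i ⟶ y i)
    (g : y i ⟶ z i) : castHom e f ≫ castHom e g = castHom e (f ≫ g) := by
  subst e
  rfl

open Classical in
/-- The canonical functor from the funny tensor product to the cartesian product. -/
noncomputable def toPi (A : I → Type) [∀ i, SmallCategory (A i)] : Funny A ⥤ ∀ i, A i :=
  lift (fun x => x.pt)
    (fun {x y} i f h j => if hj : j = i then castHom hj f else eqToHom (h j hj))
    (fun x i => by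
      funext j
      by_cases hj : j = i
      · subst hj; simp
      · simp [hj])
    (fun x y z i f g hf hg => by
      funext j
      by_cases hj : j = i
      · subst hj; simp
      · simp [hj])

/-- The funny tensor product of functors. -/
def map {B : I → Type} [∀ i, SmallCategory (B i)] (F : ∀ i, A i ⥤ B i) : Funny A ⥤ Funny B :=
  lift (fun x => mk fun i => (F i).obj (x.pt i))
    (fun {x y} i f h => step i ((F i).map f) fun j hj => congrArg (F j).obj (h j hj))
    (fun x i => by
      have := step_id (mk fun i => (F i).obj (x.pt i)) i
      simpa using this)
    (fun x y z i f g hf hg => by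
      rw [step_comp]
      congr 1
      exact ((F i).map_comp f g).symm)

/-- The inclusion of a category as the funny tensor product of a one-member family. -/
def single (B : Type) [SmallCategory B] : B ⥤ Funny (fun _ : Unit => B) where
  obj b := mk fun _ => b
  map {a b} f := step (x := mk fun _ => a) (y := mk fun _ => b) () f fun _ h => (h rfl).elim
  map_id b := step_id (mk fun _ => b) ()
  map_comp {a b c} f g := (step_comp (x := mk fun _ => a) (y := mk fun _ => b)
    (z := mk fun _ => c) () f g _ _).symm

open Classical in
/-- The functor that forgets the coordinates outside of `J ⊆ I`: the reindexing isomorphism when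
`s` is bijective, and the projection to a square when `J` has two elements. -/
noncomputable def pull {J : Type} (s : J ↪ I) : Funny A ⥤ Funny (fun j => A (s j)) :=
  lift (fun x => mk fun j => x.pt (s j))
    (fun {x y} i f h => if hi : ∃ j, s j = i then
        step (x := mk fun j => x.pt (s j)) (y := mk fun j => y.pt (s j)) hi.choose
          (castHom (x := x.pt) (y := y.pt) hi.choose_spec f)
          (fun k hk => h (s k) fun e => hk (s.injective (e.trans hi.choose_spec.symm)))
      else eqToHom (ext' fun j => h (s j) fun e => hi ⟨j, e⟩))
    (fun x i => by
      by_cases hi : ∃ j, s j = i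
      · rw [dif_pos hi]
        rw [step_eqToHom (x := mk fun j => x.pt (s j)) (y := mk fun j => x.pt (s j))
          (e := rfl) (hf := castHom_id (x := x.pt) hi.choose_spec)]
        rfl
      · rw [dif_neg hi, eqToHom_refl])
    (fun x y z i f g hf hg => by
      by_cases hi : ∃ j, s j = i
      · simp only [dif_pos hi]
        rw [step_comp]
        congr 1
        exact castHom_comp _ _ _
      · simp only [dif_neg hi]
        simp)

theorem pull_step {J : Type} (s : J ↪ I) {x y : Funny A} (j : J) (f : x.pt (s j) ⟶ y.pt (s j))
    (h : ∀ i, i ≠ s j → x.pt i = y.pt i) :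
    (pull s).map (step (s j) f h) = step (x := mk fun j => x.pt (s j))
      (y := mk fun j => y.pt (s j)) j f (fun k hk => h (s k) fun e => hk (s.injective e)) := by
  have hi : ∃ k, s k = s j := ⟨j, rfl⟩
  have hc : hi.choose = j := s.injective hi.choose_spec
  unfold pull
  refine (lift_step _ _ _ _ _).trans ?_
  rw [dif_pos hi]
  have : ∀ (k : J) (hk : k = j) (e) (h'), step (x := mk fun j => x.pt (s j))
      (y := mk fun j => y.pt (s j)) k (castHom (x := x.pt) (y := y.pt) e f) h' =
      step (x := mk fun j => x.pt (s j)) (y := mk fun j => y.pt (s j)) j f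
        (fun k hk => h (s k) fun e => hk (s.injective e)) := by
    intro k hk e h'
    subst hk
    rfl
  exact this _ hc _ _

theorem pull_step_of_not_mem {J : Type} (s : J ↪ I) {x y : Funny A} (i : I)
    (hi : ¬ ∃ j, s j = i) (f : x.pt i ⟶ y.pt i) (h : ∀ j, j ≠ i → x.pt j = y.pt j) :
    (pull s).map (step i f h) = eqToHom (ext' fun j => h (s j) fun e => hi ⟨j, e⟩) := by
  unfold pull
  refine (lift_step _ _ _ _ _).trans ?_
  rw [dif_neg hi]
  rfl

section flatten

variable {J : I → Type} {B : ∀ i, J i → Type} [∀ i j, SmallCategory (B i j)]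

/-- The inclusion of the `i`-th row. Here `R` places a family into the `i`-th row of a fixed
double family. -/
def rowAux (i : I) (R : (∀ j, B i j) → ∀ q : Σ i, J i, B q.1 q.2)
    (hR : ∀ x j, R x ⟨i, j⟩ = x j) (hR' : ∀ x y q, q.1 ≠ i → R x q = R y q) :
    Funny (B i) ⥤ Funny (fun q : Σ i, J i => B q.1 q.2) :=
  lift (fun x => mk (R x.pt))
    (fun {x y} j f h => step (x := mk (R x.pt)) (y := mk (R y.pt)) ⟨i, j⟩
      (eqToHom (hR x.pt j) ≫ f ≫ eqToHom (hR y.pt j).symm) (by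
        rintro ⟨i', j'⟩ hq
        by_cases hi : i' = i
        · subst hi
          change R x.pt ⟨i', j'⟩ = R y.pt ⟨i', j'⟩
          rw [hR, hR]
          exact h j' fun e => hq (by rw [e])
        · exact hR' _ _ _ hi))
    (fun x j => by
      rw [step_eqToHom (e := rfl) (hf := by simp)]
      rfl)
    (fun {x y z} j f g hf hg => by
      rw [step_comp]
      congr 1
      simp)

open Classical in
/-- Replaces the `i`-th row of the double family `u`. -/
noncomputable def rowPt (i : I) (u : ∀ i j, B i j) (x : ∀ j, B i j) :
    ∀ q : Σ i, J i, B q.1 q.2 :=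
  fun q => Function.update u i x q.1 q.2

open Classical in
theorem rowPt_congr (i : I) {u v : ∀ i j, B i j} (h : ∀ k, k ≠ i → u k = v k) :
    rowPt i u = rowPt i v := by
  funext x q
  unfold rowPt
  by_cases hq : q.1 = i
  · rcases q with ⟨k, l⟩
    subst hq
    simp
  · rw [Function.update_of_ne hq, Function.update_of_ne hq, h _ hq]

/-- The inclusion of the `i`-th row, the other rows being those of `u`. -/
noncomputable def row (i : I) (u : ∀ i j, B i j) :
    Funny (B i) ⥤ Funny (fun q : Σ i, J i => B q.1 q.2) :=
  rowAux i (rowPt i u) (fun x j => by simp [rowPt]) (fun x y q hq => by simp [rowPt, hq])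

theorem row_map_congr (i : I) {u v : ∀ i j, B i j} (h : ∀ k, k ≠ i → u k = v k)
    {x y : Funny (B i)} (f : x ⟶ y) :
    (row i u).map f = eqToHom (by unfold row; simp only [rowPt_congr i h]) ≫ (row i v).map f ≫
      eqToHom (by unfold row; simp only [rowPt_congr i h]) := by
  have key : ∀ (R R') (hR : ∀ x j, R x ⟨i, j⟩ = x j) (hR' : ∀ x y q, q.1 ≠ i → R x q = R y q)
      (kR) (kR') (e : R = R') (e1) (e2), (rowAux (B := B) i R hR hR').map f =
        eqToHom e1 ≫ (rowAux i R' kR kR').map f ≫ eqToHom e2 := by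
    intro R R' hR hR' kR kR' e e1 e2
    subst e
    exact ((Category.id_comp _).trans (Category.comp_id _)).symm
  exact key _ _ _ _ _ _ (rowPt_congr i h) _ _

theorem row_step (i : I) (u : ∀ i j, B i j) {x y : Funny (B i)} (j : J i) (f : x.pt j ⟶ y.pt j)
    (h : ∀ k, k ≠ j → x.pt k = y.pt k) :
    ∃ (f' : rowPt i u x.pt ⟨i, j⟩ ⟶ rowPt i u y.pt ⟨i, j⟩) (h' : ∀ q, q ≠ ⟨i, j⟩ →
      rowPt i u x.pt q = rowPt i u y.pt q), (row i u).map (step j f h) =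
        step (x := ⟨rowPt i u x.pt⟩) (y := ⟨rowPt i u y.pt⟩) ⟨i, j⟩ f' h' := by
  unfold row rowAux
  exact ⟨_, _, lift_step _ _ j f h⟩

theorem flatten_aux {u v : ∀ i j, B i j} (i : I) (h : ∀ k, k ≠ i → u k = v k) :
    rowPt i u (v i) = fun q : Σ i, J i => v q.1 q.2 := by
  rw [rowPt_congr i h]
  funext q
  simp [rowPt]

theorem row_obj {x y : Funny (fun i => Funny (B i))} (i : I)
    (h : ∀ k, k ≠ i → (x.pt k).pt = (y.pt k).pt) :
    (row i fun i => (x.pt i).pt).obj (y.pt i) =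
      mk (A := fun q : Σ i, J i => B q.1 q.2) fun q => (y.pt q.1).pt q.2 :=
  congrArg mk (flatten_aux i h)

/-- The associativity isomorphism of the funny tensor product, in the direction
`□ i, □ j, B i j ⥤ □ (i, j), B i j`. -/
noncomputable def flatten (B : ∀ i, J i → Type) [∀ i j, SmallCategory (B i j)] :
    Funny (fun i => Funny (B i)) ⥤ Funny (fun q : Σ i, J i => B q.1 q.2) :=
  lift (fun x => mk fun q => (x.pt q.1).pt q.2)
    (fun {x y} i f h =>
      eqToHom (row_obj i fun _ _ => rfl).symm ≫ (row i fun i => (x.pt i).pt).map f ≫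
        eqToHom (row_obj i fun j hj => by rw [h j hj]))
    (fun x i => by
      rw [CategoryTheory.Functor.map_id, Category.id_comp, eqToHom_trans, eqToHom_refl])
    (fun x y z i f g hf hg => by
      rw [row_map_congr i (u := fun i => (y.pt i).pt) (v := fun i => (x.pt i).pt)
        (fun k hk => by rw [hf k hk]) g]
      simp only [Category.assoc, eqToHom_trans, eqToHom_trans_assoc, CategoryTheory.Functor.map_comp,
        eqToHom_refl, Category.id_comp])

theorem flatten_step {x y : Funny (fun i => Funny (B i))} (i : I) (f : x.pt i ⟶ y.pt i)
    (h : ∀ j, j ≠ i → x.pt j = y.pt j) :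
    (flatten B).map (step i f h) =
      eqToHom (row_obj i fun _ _ => rfl).symm ≫ (row i fun i => (x.pt i).pt).map f ≫
        eqToHom (row_obj i fun j hj => by rw [h j hj]) :=
  lift_step _ _ _ _ _

/-- The functor `□ i, A i ⥤ □ (i, j), B i j` induced by functors `A i ⥤ □ j, B i j`. -/
noncomputable def subst (ω : ∀ i, A i ⥤ Funny (B i)) :
    Funny A ⥤ Funny (fun q : Σ i, J i => B q.1 q.2) :=
  map ω ⋙ flatten B

theorem subst_step (ω : ∀ i, A i ⥤ Funny (B i)) {x y : Funny A} (i : I) (f : x.pt i ⟶ y.pt i)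
    (h : ∀ j, j ≠ i → x.pt j = y.pt j) :
    ∃ (e : (subst ω).obj x = (row i fun i => ((ω i).obj (x.pt i)).pt).obj ((ω i).obj (x.pt i)))
      (e' : (row i fun i => ((ω i).obj (x.pt i)).pt).obj ((ω i).obj (y.pt i)) = (subst ω).obj y),
      (subst ω).map (step i f h) =
        eqToHom e ≫ (row i fun i => ((ω i).obj (x.pt i)).pt).map ((ω i).map f) ≫ eqToHom e' := by
  have h1 : (map ω).map (step i f h) = step (x := (map ω).obj x) (y := (map ω).obj y) i
      ((ω i).map f) (fun j hj => congrArg (ω j).obj (h j hj)) := lift_step _ _ i f h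
  exact ⟨_, _, (congrArg (flatten B).map h1).trans
    (flatten_step (x := (map ω).obj x) (y := (map ω).obj y) i _ _)⟩

end flatten

end Funny

end Funny

/-! ### Intervals and directions of movement -/

/-- The interval `⟨n⟩`: the category freely generated by `0 → 1 → ⋯ → n`, i.e. the linear order
`0 < 1 < ⋯ < n` regarded as a category. -/
def Interval (n : ℕ) : Type := Fin (n + 1)

namespace Interval

instance (n : ℕ) : SmallCategory (Interval n) := inferInstanceAs (SmallCategory (Fin (n + 1)))

instance {n : ℕ} (a b : Interval n) : Subsingleton (a ⟶ b) :=
  inferInstanceAs (Subsingleton (Quiver.Hom (V := Fin (n + 1)) a b))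

/-- The underlying number of an object. -/
def val {n : ℕ} (a : Interval n) : ℕ := Fin.val (n := n + 1) a

theorem val_inj {n : ℕ} {a b : Interval n} : a.val = b.val ↔ a = b := Fin.val_inj (n := n + 1)

/-- The object with a given number. -/
def of {n : ℕ} (k : ℕ) (h : k ≤ n) : Interval n := (⟨k, Nat.lt_succ_of_le h⟩ : Fin (n + 1))

@[simp] theorem val_of {n : ℕ} (k : ℕ) (h : k ≤ n) : (of k h).val = k := rfl

/-- The distinguished initial object. -/
def bot (n : ℕ) : Interval n := of 0 (Nat.zero_le n)

/-- The distinguished terminal object. -/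
def top (n : ℕ) : Interval n := of n le_rfl

@[simp] theorem val_bot (n : ℕ) : (bot n).val = 0 := rfl
@[simp] theorem val_top (n : ℕ) : (top n).val = n := rfl

theorem val_le {n : ℕ} {a b : Interval n} (f : a ⟶ b) : a.val ≤ b.val :=
  leOfHom (X := Fin (n + 1)) f

/-- The morphism given by an inequality. -/
def hom {n : ℕ} {a b : Interval n} (h : a.val ≤ b.val) : a ⟶ b :=
  homOfLE (X := Fin (n + 1)) h

theorem val_le_top {n : ℕ} (a : Interval n) : a.val ≤ n := Nat.le_of_lt_succ (Fin.isLt a)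

/-- The morphism from the initial to the terminal object. -/
def total (n : ℕ) : bot n ⟶ top n := hom (Nat.zero_le n)

end Interval

section Directions

variable {I : Type}

/-- The functor from a funny tensor product of intervals to the one-object category of words that
sends a morphism in the coordinate `i` to a power of the letter `i`. -/
def wordFunctor (I : Type) (c : I → ℕ) :
    Funny (fun i => Interval (c i)) ⥤ SingleObj (FreeMonoid I)ᵐᵒᵖ :=
  Funny.lift (fun _ => SingleObj.star _)
    (fun {x y} i _ _ =>
      MulOpposite.op (FreeMonoid.ofList (List.replicate ((y.pt i).val - (x.pt i).val) i)))
    (fun x i => by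
      rw [Nat.sub_self]
      rfl)
    (fun x y z i f g hf hg => by
      rw [SingleObj.comp_as_mul, ← MulOpposite.op_mul, ← FreeMonoid.ofList_append,
        List.replicate_append_replicate]
      have h1 := Interval.val_le f
      have h2 := Interval.val_le g
      congr 3
      omega)

/-- The word of directions of a morphism in a funny tensor product of intervals: a lattice path
that moves along the generators in the directions `i₁, i₂, …` has the word `[i₁, i₂, …]`. -/
def dirs {c : I → ℕ} {x y : Funny (fun i => Interval (c i))} (f : x ⟶ y) : List I :=
  FreeMonoid.toList (MulOpposite.unop ((wordFunctor I c).map f : (FreeMonoid I)ᵐᵒᵖ))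

variable {c : I → ℕ}

@[simp] theorem dirs_id (x : Funny (fun i => Interval (c i))) : dirs (𝟙 x) = [] := by
  unfold dirs
  rw [CategoryTheory.Functor.map_id]
  rfl

@[simp] theorem dirs_comp {x y z : Funny (fun i => Interval (c i))} (f : x ⟶ y) (g : y ⟶ z) :
    dirs (f ≫ g) = dirs f ++ dirs g := by
  unfold dirs
  rw [CategoryTheory.Functor.map_comp]
  rfl

@[simp] theorem dirs_step {x y : Funny (fun i => Interval (c i))} (i : I) (f : x.pt i ⟶ y.pt i)
    (h : ∀ j, j ≠ i → x.pt j = y.pt j) :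
    dirs (Funny.step i f h) = List.replicate ((y.pt i).val - (x.pt i).val) i := by
  unfold dirs wordFunctor
  rw [Funny.lift_step]
  rfl

@[simp] theorem dirs_eqToHom {x y : Funny (fun i => Interval (c i))} (e : x = y) :
    dirs (eqToHom e) = [] := by
  subst e
  exact dirs_id x

theorem dirs_conj {x x' y y' : Funny (fun i => Interval (c i))} (e : x' = x) (e' : y = y')
    (f : x ⟶ y) : dirs (eqToHom e ≫ f ≫ eqToHom e') = dirs f := by
  subst e e'
  simp

theorem dirs_map_conj {D : Type*} [Category* D] (F : D ⥤ Funny (fun i => Interval (c i)))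
    {x x' y y' : D} (e : x' = x) (e' : y = y') (f : x ⟶ y) :
    dirs (F.map (eqToHom e ≫ f ≫ eqToHom e')) = dirs (F.map f) := by
  subst e e'
  simp

/-- A morphism is an identity, or it starts with a single step. -/
theorem dirs_cases {x y : Funny (fun i => Interval (c i))} (f : x ⟶ y) :
    (dirs f = [] → ∃ e : x = y, f = eqToHom e) ∧
    ∀ i w, dirs f = i :: w → ∃ (x' : Funny (fun i => Interval (c i))) (s : x.pt i ⟶ x'.pt i)
      (h : ∀ j, j ≠ i → x.pt j = x'.pt j) (f' : x' ⟶ y),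
      (x'.pt i).val = (x.pt i).val + 1 ∧ f = Funny.step i s h ≫ f' ∧ dirs f' = w := by
  induction f using Funny.hom_induction with
  | hid x => exact ⟨fun _ => ⟨rfl, rfl⟩, fun i w h => by simp at h⟩
  | @hcomp x y z f g hf hg =>
    rcases hw : dirs f with _ | ⟨i, w⟩
    · obtain ⟨e, he⟩ := hf.1 hw
      subst e
      rw [he, eqToHom_refl, Category.id_comp]
      exact hg
    · obtain ⟨x', s, h, f', hv, hs, hf'⟩ := hf.2 i w hw
      refine ⟨fun h0 => by simp [hw] at h0, fun i' w' h0 => ?_⟩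
      rw [dirs_comp, hw] at h0
      simp only [List.cons_append, List.cons.injEq] at h0
      obtain ⟨rfl, rfl⟩ := h0
      exact ⟨x', s, h, f' ≫ g, hv, by rw [hs, Category.assoc], by rw [dirs_comp, hf']⟩
  | @hstep x y i f h =>
    have hle := Interval.val_le f
    rcases Nat.eq_or_lt_of_le hle with he | hlt
    · have e : x.pt i = y.pt i := Interval.val_inj.1 he
      refine ⟨fun _ => ⟨_, Funny.step_eqToHom i f h e (Subsingleton.elim _ _)⟩, fun i' w hw => ?_⟩
      rw [dirs_step, he, Nat.sub_self] at hw
      simp at hw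
    · refine ⟨fun h0 => ?_, fun i' w hw => ?_⟩
      · rw [dirs_step, List.replicate_eq_nil_iff] at h0
        omega
      · rw [dirs_step] at hw
        obtain ⟨k, hk⟩ : ∃ k, (y.pt i).val - (x.pt i).val = k + 1 := ⟨_, (Nat.succ_pred_eq_of_pos
          (Nat.sub_pos_of_lt hlt)).symm⟩
        rw [hk, List.replicate_succ, List.cons.injEq] at hw
        obtain ⟨rfl, rfl⟩ := hw
        classical
        have hb : (x.pt i).val + 1 ≤ c i := hlt.trans_le (Interval.val_le_top (y.pt i))
        let x' : Funny (fun i => Interval (c i)) :=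
          ⟨Function.update x.pt i (Interval.of ((x.pt i).val + 1) hb)⟩
        have hx' : x'.pt i = Interval.of ((x.pt i).val + 1) hb := by
          simp [x']
        have hx'j : ∀ j, j ≠ i → x.pt j = x'.pt j := fun j hj =>
          (Function.update_of_ne hj _ _).symm
        have hv : (x'.pt i).val = (x.pt i).val + 1 := by rw [hx']; rfl
        refine ⟨x', Interval.hom (by omega), hx'j, Funny.step i (Interval.hom (by omega))
          (fun j hj => (hx'j j hj).symm.trans (h j hj)), hv, ?_, ?_⟩
        · rw [Funny.step_comp]
          congr 1
        · rw [dirs_step]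
          congr 1
          omega

/-- A morphism in a funny tensor product of intervals is determined by its endpoints and its word
of directions. -/
theorem dirs_injective {x y : Funny (fun i => Interval (c i))} {f g : x ⟶ y}
    (h : dirs f = dirs g) : f = g := by
  induction hw : dirs f generalizing x with
  | nil =>
    obtain ⟨_, hf⟩ := (dirs_cases f).1 hw
    obtain ⟨_, hg⟩ := (dirs_cases g).1 (h ▸ hw)
    rw [hf, hg]
  | cons i w ih =>
    obtain ⟨x1, s1, h1, f', hv1, rfl, hf'⟩ := (dirs_cases f).2 i w hw
    obtain ⟨x2, s2, h2, g', hv2, rfl, hg'⟩ := (dirs_cases g).2 i w (h ▸ hw)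
    have e : x1 = x2 := by
      refine Funny.ext' fun j => ?_
      by_cases hj : j = i
      · subst hj
        exact Interval.val_inj.1 (by rw [hv1, hv2])
      · rw [← h1 j hj, h2 j hj]
    subst e
    rw [ih (hf'.trans hg'.symm) hf', Subsingleton.elim s1 s2]

open Classical in
/-- The number of moves in the direction `i`. -/
theorem count_dirs {x y : Funny (fun i => Interval (c i))} (f : x ⟶ y) (i : I) :
    (x.pt i).val + (dirs f).count i = (y.pt i).val := by
  induction f using Funny.hom_induction with
  | hid x => simp
  | hcomp f g hf hg => rw [dirs_comp, List.count_append, ← hg, ← hf, Nat.add_assoc]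
  | @hstep x y j f h =>
    rw [dirs_step]
    by_cases hj : i = j
    · subst hj
      have := Interval.val_le f
      rw [List.count_replicate_self]
      omega
    · rw [h i hj, List.count_replicate, if_neg (by simpa using fun e => hj e.symm)]
      rfl

/-- Two functors to a funny tensor product of intervals are equal if they agree on objects and
words of directions. -/
theorem functor_ext {D : Type*} [Category* D] {F G : D ⥤ Funny (fun i => Interval (c i))}
    (hobj : ∀ a, F.obj a = G.obj a) (hmap : ∀ {a b : D} (f : a ⟶ b),
      dirs (F.map f) = dirs (G.map f)) : F = G :=
  CategoryTheory.Functor.ext hobj fun a b f => dirs_injective (by simp [hmap])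

theorem dirs_pull {J : Type} (s : J ↪ I) {x y : Funny (fun i => Interval (c i))} (f : x ⟶ y) :
    (dirs (c := fun j => c (s j)) ((Funny.pull s).map f)).map s =
      (dirs f).filter (fun i => by classical exact decide (∃ j, s j = i)) := by
  classical
  induction f using Funny.hom_induction with
  | hid x =>
    rw [CategoryTheory.Functor.map_id, dirs_id, dirs_id]
    rfl
  | hcomp f g hf hg =>
    rw [CategoryTheory.Functor.map_comp, dirs_comp, dirs_comp, List.map_append,
      List.filter_append, hf, hg]
  | @hstep x y i f h =>
    by_cases hi : ∃ j, s j = i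
    · obtain ⟨j, rfl⟩ := hi
      rw [Funny.pull_step]
      refine (congrArg (List.map s) (dirs_step (c := fun j => c (s j))
        (x := ⟨fun j => x.pt (s j)⟩) (y := ⟨fun j => y.pt (s j)⟩) j f _)).trans ?_
      rw [dirs_step, List.map_replicate, List.filter_replicate]
      simp
    · rw [Funny.pull_step_of_not_mem s i hi]
      rw [dirs_eqToHom (c := fun j => c (s j)), dirs_step, List.filter_replicate]
      simp [hi]

theorem dirs_row {J : I → Type} {e : ∀ i, J i → ℕ} (i : I) (u : ∀ i j, Interval (e i j))
    {x y : Funny (fun j => Interval (e i j))} (f : x ⟶ y) :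
    dirs (c := fun q : Σ i, J i => e q.1 q.2) ((Funny.row i u).map f) =
      (dirs f).map (Sigma.mk i) := by
  induction f using Funny.hom_induction with
  | hid x =>
    rw [CategoryTheory.Functor.map_id, dirs_id, dirs_id]
    rfl
  | hcomp f g hf hg =>
    rw [CategoryTheory.Functor.map_comp, dirs_comp, dirs_comp, List.map_append, hf, hg]
  | @hstep x y j f h =>
    obtain ⟨f', h', hf⟩ := Funny.row_step i u j f h
    rw [hf]
    refine (dirs_step (c := fun q : Σ i, J i => e q.1 q.2) (x := ⟨Funny.rowPt i u x.pt⟩)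
      (y := ⟨Funny.rowPt i u y.pt⟩) ⟨i, j⟩ _ _).trans ?_
    rw [dirs_step, List.map_replicate]
    simp [Funny.rowPt]

end Directions

/-! ### The lattice path operad -/

section Subst

variable {I : Type} {J : I → Type} {c : I → ℕ} {e : ∀ i, J i → ℕ}

theorem dirs_subst_step (ω : ∀ i, Interval (c i) ⥤ Funny (fun j => Interval (e i j)))
    {x y : Funny (fun i => Interval (c i))} (i : I) (f : x.pt i ⟶ y.pt i)
    (h : ∀ j, j ≠ i → x.pt j = y.pt j) :
    dirs (c := fun q : Σ i, J i => e q.1 q.2) ((Funny.subst ω).map (Funny.step i f h)) =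
      (dirs ((ω i).map f)).map (Sigma.mk i) := by
  obtain ⟨e1, e2, he⟩ := Funny.subst_step ω i f h
  rw [he]
  exact (dirs_conj (c := fun q : Σ i, J i => e q.1 q.2) _ _ _).trans (dirs_row i _ _)

theorem dirs_map_congr {m : ℕ} (F : Interval m ⥤ Funny (fun i => Interval (c i)))
    {a b a' b' : Interval m} (ha : a = a') (hb : b = b') (f : a ⟶ b) (f' : a' ⟶ b') :
    dirs (F.map f) = dirs (F.map f') := by
  subst ha hb
  rw [Subsingleton.elim f f']

theorem dirs_pull_equiv {I' : Type} (s : I' ≃ I)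
    {x y : Funny (fun i => Interval (c i))} (f : x ⟶ y) :
    dirs (c := fun j => c (s j)) ((Funny.pull s.toEmbedding).map f) = (dirs f).map s.symm := by
  have h := dirs_pull s.toEmbedding f
  rw [List.filter_eq_self.2 (fun i _ => by simpa using ⟨s.symm i, s.apply_symm_apply i⟩)] at h
  rw [← h, List.map_map]
  simp

theorem dirs_subst_pull {I' : Type} (s : I' ≃ I)
    (ω : ∀ i, Interval (c i) ⥤ Funny (fun j => Interval (e i j)))
    {x y : Funny (fun i => Interval (c i))} (g : x ⟶ y) :
    dirs (c := fun q : Σ i, J (s i) => e (s q.1) q.2)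
      ((Funny.subst (A := fun i => Interval (c (s i))) fun i => ω (s i)).map
        ((Funny.pull s.toEmbedding).map g)) =
      (dirs (c := fun q : Σ i, J i => e q.1 q.2) ((Funny.subst ω).map g)).map
        (Equiv.sigmaCongrLeft s).symm := by
  induction g using Funny.hom_induction with
  | hid x => simp only [CategoryTheory.Functor.map_id, dirs_id, List.map_nil]
  | hcomp f g hf hg =>
    simp only [CategoryTheory.Functor.map_comp, dirs_comp, List.map_append, hf, hg]
  | @hstep x y i f h =>
    obtain ⟨j, rfl⟩ := s.surjective i
    have := Funny.pull_step s.toEmbedding (x := x) (y := y) j f h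
    refine (congrArg (fun g => dirs (c := fun q : Σ i, J (s i) => e (s q.1) q.2)
      ((Funny.subst (A := fun i => Interval (c (s i))) fun i => ω (s i)).map g)) this).trans ?_
    refine (dirs_subst_step (c := fun i => c (s i)) (fun i => ω (s i)) (x := ⟨fun j => x.pt (s j)⟩)
      (y := ⟨fun j => y.pt (s j)⟩) j f _).trans ?_
    rw [dirs_subst_step, List.map_map]
    refine List.map_congr_left fun k _ => ?_
    exact ((Equiv.sigmaCongrLeft s).symm_apply_apply ⟨j, k⟩).symm

theorem dirs_pull_subst {J' : I → Type} (t : ∀ i, J' i ≃ J i)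
    (ω : ∀ i, Interval (c i) ⥤ Funny (fun j => Interval (e i j)))
    {x y : Funny (fun i => Interval (c i))} (g : x ⟶ y) :
    dirs (c := fun q : Σ i, J' i => e q.1 (t q.1 q.2))
      ((Funny.subst (B := fun i j => Interval (e i (t i j))) fun i =>
        ω i ⋙ Funny.pull (t i).toEmbedding).map g) =
      (dirs (c := fun q : Σ i, J i => e q.1 q.2) ((Funny.subst ω).map g)).map
        (Equiv.sigmaCongrRight t).symm := by
  induction g using Funny.hom_induction with
  | hid x => simp only [CategoryTheory.Functor.map_id, dirs_id, List.map_nil]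
  | hcomp f g hf hg =>
    simp only [CategoryTheory.Functor.map_comp, dirs_comp, List.map_append, hf, hg]
  | @hstep x y i f h =>
    refine (dirs_subst_step (e := fun i j => e i (t i j)) _ i f h).trans ?_
    rw [dirs_subst_step, List.map_map]
    refine (congrArg (List.map _) (dirs_pull_equiv (t i) _)).trans ?_
    rw [List.map_map]
    rfl

theorem dirs_single {m : ℕ} {a b : Interval m} (f : a ⟶ b) :
    dirs (c := fun _ : Unit => m) ((Funny.single (Interval m)).map f) =
      List.replicate (b.val - a.val) () :=
  dirs_step (c := fun _ : Unit => m) (x := ⟨fun _ => a⟩) (y := ⟨fun _ => b⟩) () f _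

theorem dirs_subst_single {x y : Funny (fun i => Interval (c i))} (g : x ⟶ y) :
    dirs (c := fun q : Σ _ : I, Unit => c q.1)
      ((Funny.subst (B := fun i _ => Interval (c i)) fun i => Funny.single (Interval (c i))).map g) =
      (dirs g).map (Equiv.sigmaUnique I fun _ => Unit).symm := by
  induction g using Funny.hom_induction with
  | hid x => simp only [CategoryTheory.Functor.map_id, dirs_id, List.map_nil]
  | hcomp f g hf hg =>
    simp only [CategoryTheory.Functor.map_comp, dirs_comp, List.map_append, hf, hg]
  | @hstep x y i f h =>
    refine (dirs_subst_step (e := fun i _ => c i) _ i f h).trans ?_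
    rw [dirs_step, List.map_replicate, dirs_single, List.map_replicate]
    rfl

theorem dirs_subst_row {K : ∀ i, J i → Type} {d : ∀ i j, K i j → ℕ}
    (χ : ∀ i j, Interval (e i j) ⥤ Funny (fun k => Interval (d i j k)))
    (i : I) (u : ∀ i j, Interval (e i j)) {x y : Funny (fun j => Interval (e i j))} (g : x ⟶ y) :
    dirs (c := fun q : Σ q : (Σ i, J i), K q.1 q.2 => d q.1.1 q.1.2 q.2)
      ((Funny.subst (A := fun q : Σ i, J i => Interval (e q.1 q.2))
        (B := fun q k => Interval (d q.1 q.2 k)) fun q => χ q.1 q.2).map ((Funny.row i u).map g)) =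
      (dirs (c := fun q : Σ j, K i j => d i q.1 q.2) ((Funny.subst (χ i)).map g)).map
        fun q => ⟨⟨i, q.1⟩, q.2⟩ := by
  induction g using Funny.hom_induction with
  | hid x => simp only [CategoryTheory.Functor.map_id, dirs_id, List.map_nil]
  | hcomp f g hf hg =>
    simp only [CategoryTheory.Functor.map_comp, dirs_comp, List.map_append, hf, hg]
  | @hstep x y j f h =>
    obtain ⟨f', h', hf⟩ := Funny.row_step i u j f h
    rw [hf]
    refine (dirs_subst_step (c := fun q : Σ i, J i => e q.1 q.2) (e := fun q k => d q.1 q.2 k)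
      (fun q => χ q.1 q.2) (x := ⟨Funny.rowPt i u x.pt⟩) (y := ⟨Funny.rowPt i u y.pt⟩) ⟨i, j⟩ f'
      h').trans ?_
    rw [dirs_subst_step, List.map_map]
    refine congrArg (List.map _) (dirs_map_congr (χ i j) ?_ ?_ _ _) <;> simp [Funny.rowPt]

theorem dirs_subst_subst {K : ∀ i, J i → Type} {d : ∀ i j, K i j → ℕ}
    (ω : ∀ i, Interval (c i) ⥤ Funny (fun j => Interval (e i j)))
    (χ : ∀ i j, Interval (e i j) ⥤ Funny (fun k => Interval (d i j k)))
    {x y : Funny (fun i => Interval (c i))} (g : x ⟶ y) :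
    dirs (c := fun q : Σ q : (Σ i, J i), K q.1 q.2 => d q.1.1 q.1.2 q.2)
      ((Funny.subst (A := fun q : Σ i, J i => Interval (e q.1 q.2))
        (B := fun q k => Interval (d q.1 q.2 k)) fun q => χ q.1 q.2).map ((Funny.subst ω).map g)) =
      (dirs (c := fun q : Σ i, Σ j, K i j => d q.1 q.2.1 q.2.2)
        ((Funny.subst (B := fun i (q : Σ j, K i j) => Interval (d i q.1 q.2))
          fun i => ω i ⋙ Funny.subst (χ i)).map g)).map (Equiv.sigmaAssoc K).symm := by
  induction g using Funny.hom_induction with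
  | hid x => simp only [CategoryTheory.Functor.map_id, dirs_id, List.map_nil]
  | hcomp f g hf hg =>
    simp only [CategoryTheory.Functor.map_comp, dirs_comp, List.map_append, hf, hg]
  | @hstep x y i f h =>
    obtain ⟨e1, e2, he⟩ := Funny.subst_step ω i f h
    rw [he]
    refine (dirs_map_conj (c := fun q : Σ q : (Σ i, J i), K q.1 q.2 => d q.1.1 q.1.2 q.2)
      _ _ _ _).trans ?_
    refine (dirs_subst_row χ i _ _).trans ?_
    rw [dirs_subst_step, List.map_map]
    rfl

end Subst

/-- The set `Cat_{*,*}(⟨m⟩, □ i, ⟨c i⟩)` of functors that preserve the distinguished objects. -/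
def IntervalPath {I : Type} (m : ℕ) (c : I → ℕ) : Type :=
  {F : Interval m ⥤ Funny (fun i => Interval (c i)) //
    F.obj (Interval.bot m) = ⟨fun i => Interval.bot (c i)⟩ ∧
    F.obj (Interval.top m) = ⟨fun i => Interval.top (c i)⟩}

namespace IntervalPath

variable {I : Type} {m : ℕ} {c : I → ℕ}

/-- The word of directions of the whole path. -/
def word (ψ : IntervalPath m c) : List I := dirs (ψ.1.map (Interval.total m))

theorem ext {ψ ω : IntervalPath m c} (hobj : ∀ a, ψ.1.obj a = ω.1.obj a)
    (hmap : ∀ {a b : Interval m} (f : a ⟶ b), dirs (ψ.1.map f) = dirs (ω.1.map f)) : ψ = ω :=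
  Subtype.ext (functor_ext hobj hmap)

/-- The projection of a path to some of the coordinates. -/
noncomputable def pull {J : Type} (s : J ↪ I) (ψ : IntervalPath m c) :
    IntervalPath m (fun j => c (s j)) :=
  ⟨ψ.1 ⋙ Funny.pull s, by
    constructor
    · change (Funny.pull s).obj (ψ.1.obj _) = _
      rw [ψ.2.1]
      rfl
    · change (Funny.pull s).obj (ψ.1.obj _) = _
      rw [ψ.2.2]
      rfl⟩

/-- Substitution of paths, induced by the funny tensor product and composition of functors. -/
noncomputable def subst {J : I → Type} {e : ∀ i, J i → ℕ} (ψ : IntervalPath m c)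
    (ω : ∀ i, IntervalPath (c i) (e i)) : IntervalPath m (fun q : Σ i, J i => e q.1 q.2) :=
  ⟨ψ.1 ⋙ Funny.subst fun i => (ω i).1, by
    constructor
    · change (Funny.subst fun i => (ω i).1).obj (ψ.1.obj _) = _
      rw [ψ.2.1]
      refine Funny.ext' fun q => ?_
      change (((ω q.1).1.obj (Interval.bot _)).pt q.2) = _
      rw [(ω q.1).2.1]
    · change (Funny.subst fun i => (ω i).1).obj (ψ.1.obj _) = _
      rw [ψ.2.2]
      refine Funny.ext' fun q => ?_
      change (((ω q.1).1.obj (Interval.top _)).pt q.2) = _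
      rw [(ω q.1).2.2]⟩

/-- The identity path. -/
def single (m : ℕ) : IntervalPath m (fun _ : Unit => m) := ⟨Funny.single (Interval m), rfl, rfl⟩

end IntervalPath

/-- The lattice path operad `L`, with
`L(n₁, …, n_k; n) = Cat_{*,*}(⟨n + 1⟩, ⟨n₁ + 1⟩ □ ⋯ □ ⟨n_k + 1⟩)`. -/
noncomputable def latticePathOperad : Operad ℕ where
  Op c d := IntervalPath (d + 1) (fun i => c i + 1)
  one d := IntervalPath.single (d + 1)
  comp ψ ω := ψ.subst ω
  relabel s _ _ ψ := ψ.pull s.toEmbedding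
  relabel_refl ψ := by
    refine IntervalPath.ext (fun _ => rfl) fun f => ?_
    refine (dirs_pull_equiv (Equiv.refl _) (ψ.1.map f)).trans ?_
    exact List.map_id _
  relabel_trans s t _ _ ψ := by
    refine IntervalPath.ext (fun _ => rfl) fun f => ?_
    refine (dirs_pull_equiv t _).trans ?_
    refine (congrArg (List.map t.symm) (dirs_pull_equiv s (ψ.1.map f))).trans ?_
    refine Eq.trans ?_ (dirs_pull_equiv (t.trans s) (ψ.1.map f)).symm
    exact List.map_map
  comp_relabel_left s _ _ _ _ _ ψ ω := IntervalPath.ext (fun _ => rfl) fun f =>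
    (dirs_subst_pull s (fun i => (ω i).1) (ψ.1.map f)).trans
      (dirs_pull_equiv (Equiv.sigmaCongrLeft s) _).symm
  comp_relabel_right t _ _ _ ψ ω := IntervalPath.ext (fun _ => rfl) fun f =>
    (dirs_pull_subst t (fun i => (ω i).1) (ψ.1.map f)).trans
      (dirs_pull_equiv (Equiv.sigmaCongrRight t) _).symm
  one_comp {I _ c d} ψ := by
    refine IntervalPath.ext (fun _ => rfl) fun {a b} f => ?_
    refine Eq.trans (b := (dirs (ψ.1.map f)).map (Sigma.mk ())) ?_ ?_
    · exact dirs_subst_step (c := fun _ : Unit => d + 1) (e := fun _ i => c i + 1)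
        (fun _ : Unit => ψ.1) (x := ⟨fun _ => a⟩) (y := ⟨fun _ => b⟩) () f
        (fun j hj => (hj rfl).elim)
    · exact (dirs_pull_equiv (c := fun i => c i + 1) (Equiv.uniqueSigma fun _ : Unit => I)
        (ψ.1.map f)).symm
  comp_one ψ := IntervalPath.ext (fun _ => rfl) fun f =>
    (dirs_subst_single (ψ.1.map f)).trans (dirs_pull_equiv (Equiv.sigmaUnique _ _) _).symm
  assoc {_ _ _ _ K} _ _ _ _ _ ψ ω χ := IntervalPath.ext (fun _ => rfl) fun f =>
    (dirs_subst_subst (fun i => (ω i).1) (fun i j => (χ i j).1) (ψ.1.map f)).trans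
      (dirs_pull_equiv (Equiv.sigmaAssoc K) _).symm

/-! ### The paths operad -/

/-- The set `Cat_{*,*}(⟨m⟩, ∏ i, ⟨c i⟩)` of functors to the cartesian product of categories that
preserve the distinguished objects. -/
def ProductPath {I : Type} (m : ℕ) (c : I → ℕ) : Type :=
  {F : Interval m ⥤ (∀ i, Interval (c i)) //
    F.obj (Interval.bot m) = (fun i => Interval.bot (c i)) ∧
    F.obj (Interval.top m) = (fun i => Interval.top (c i))}

namespace ProductPath

variable {I : Type} {m : ℕ} {c : I → ℕ}

theorem ext {φ χ : ProductPath m c} (h : ∀ a, φ.1.obj a = χ.1.obj a) : φ = χ :=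
  Subtype.ext (CategoryTheory.Functor.ext h fun _ _ _ => funext fun _ => Subsingleton.elim _ _)

/-- Substitution of paths, induced by the cartesian product and composition of functors. -/
def subst {J : I → Type} {e : ∀ i, J i → ℕ} (φ : ProductPath m c)
    (χ : ∀ i, ProductPath (c i) (e i)) : ProductPath m (fun q : Σ i, J i => e q.1 q.2) :=
  ⟨φ.1 ⋙ CategoryTheory.Functor.pi (fun i => (χ i).1) ⋙
      CategoryTheory.Functor.pi' fun q : Σ i, J i => Pi.eval _ q.1 ⋙ Pi.eval _ q.2, by
    constructor <;> funext q
    · change (χ q.1).1.obj (φ.1.obj (Interval.bot m) q.1) q.2 = _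
      rw [φ.2.1, (χ q.1).2.1]
    · change (χ q.1).1.obj (φ.1.obj (Interval.top m) q.1) q.2 = _
      rw [φ.2.2, (χ q.1).2.2]⟩

/-- The projection of a path to some of the coordinates. -/
def pull {J : Type} (s : J → I) (φ : ProductPath m c) : ProductPath m (fun j => c (s j)) :=
  ⟨φ.1 ⋙ CategoryTheory.Functor.pi' fun j => Pi.eval _ (s j), by
    constructor <;> funext j
    · change φ.1.obj (Interval.bot m) (s j) = _
      rw [φ.2.1]
    · change φ.1.obj (Interval.top m) (s j) = _
      rw [φ.2.2]⟩

/-- The identity path. -/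
def single (m : ℕ) : ProductPath m (fun _ : Unit => m) :=
  ⟨CategoryTheory.Functor.pi' fun _ => 𝟭 _, rfl, rfl⟩

end ProductPath

/-- The paths operad `M`, with
`M(n₁, …, n_k; n) = Cat_{*,*}(⟨n + 1⟩, ⟨n₁ + 1⟩ × ⋯ × ⟨n_k + 1⟩)`. -/
def pathsOperad : Operad ℕ where
  Op c d := ProductPath (d + 1) (fun i => c i + 1)
  one d := ProductPath.single (d + 1)
  comp φ χ := φ.subst χ
  relabel s _ _ φ := φ.pull s
  relabel_refl _ := rfl
  relabel_trans _ _ _ _ _ := rfl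
  comp_relabel_left _ _ _ _ _ _ _ _ := ProductPath.ext fun _ => rfl
  comp_relabel_right _ _ _ _ _ _ := ProductPath.ext fun _ => rfl
  one_comp _ := ProductPath.ext fun _ => rfl
  comp_one _ := ProductPath.ext fun _ => rfl
  assoc _ _ _ := ProductPath.ext fun _ => rfl

/-- The path underlying a lattice path. -/
noncomputable def IntervalPath.toProduct {I : Type} {m : ℕ} {c : I → ℕ} (ψ : IntervalPath m c) :
    ProductPath m c :=
  ⟨ψ.1 ⋙ Funny.toPi _, by
    constructor
    · change (ψ.1.obj _).pt = _
      rw [ψ.2.1]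
    · change (ψ.1.obj _).pt = _
      rw [ψ.2.2]⟩

/-- The morphism `p : L → M`, induced by the canonical functors `A □ B ⥤ A × B`. -/
noncomputable def latticeToPaths : Operad.Hom latticePathOperad pathsOperad where
  app ψ := ψ.toProduct
  app_one _ := ProductPath.ext fun _ => rfl
  app_comp _ _ := ProductPath.ext fun _ => rfl
  app_relabel _ _ _ _ := ProductPath.ext fun _ => rfl

/-! ### The operad of monoids, and the operad `M^(0) = M × Ass` -/

/-- A linear order on `I`. -/
@[ext]
structure LinOrd (I : Type) where
  lt : I → I → Prop
  irrefl : ∀ i, ¬ lt i i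
  trans : ∀ i j k, lt i j → lt j k → lt i k
  total : ∀ i j, i ≠ j → lt i j ∨ lt j i

/-- The operad for monoids, with the same component for all colours. Its operations with `k` inputs
are the linear orders on the set of inputs (for the set `{1, …, k}` these are the elements of the
symmetric group); substitution is the lexicographic order. -/
def assOperad (C : Type) : Operad C where
  Op {I} _ _ _ := LinOrd I
  one _ := ⟨fun _ _ => False, fun _ h => h, fun _ _ _ h _ => h, fun _ _ h => (h rfl).elim⟩
  comp o u :=
    { lt := fun q q' => o.lt q.1 q'.1 ∨ ∃ h : q.1 = q'.1, (u q'.1).lt (h ▸ q.2) q'.2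
      irrefl := by
        rintro ⟨i, j⟩ (h | ⟨h, h'⟩)
        · exact o.irrefl _ h
        · exact (u i).irrefl _ h'
      trans := by
        rintro ⟨i, j⟩ ⟨i', j'⟩ ⟨i'', j''⟩ (h | ⟨h, h'⟩) (k | ⟨k, k'⟩)
        · exact Or.inl (o.trans _ _ _ h k)
        · dsimp only at k
          subst k
          exact Or.inl h
        · dsimp only at h
          subst h
          exact Or.inl k
        · dsimp only at h k
          subst h k
          exact Or.inr ⟨rfl, (u i).trans _ _ _ h' k'⟩
      total := by
        rintro ⟨i, j⟩ ⟨i', j'⟩ h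
        by_cases hi : i = i'
        · subst hi
          rcases (u i).total j j' (fun e => h (by rw [e])) with h' | h'
          · exact Or.inl (Or.inr ⟨rfl, h'⟩)
          · exact Or.inr (Or.inr ⟨rfl, h'⟩)
        · rcases o.total i i' hi with h' | h'
          · exact Or.inl (Or.inl h')
          · exact Or.inr (Or.inl h') }
  relabel s _ _ o :=
    { lt := fun i j => o.lt (s i) (s j)
      irrefl := fun i => o.irrefl _
      trans := fun _ _ _ => o.trans _ _ _
      total := fun i j h => o.total _ _ fun e => h (s.injective e) }
  relabel_refl _ := rfl
  relabel_trans _ _ _ _ _ := rfl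
  comp_relabel_left s J _ c e d o u := by
    refine LinOrd.ext ?_
    funext ⟨i, j⟩ ⟨i', j'⟩
    refine propext (or_congr Iff.rfl ?_)
    constructor
    · rintro ⟨h, h'⟩
      dsimp only at h
      subst h
      exact ⟨rfl, h'⟩
    · rintro ⟨h, h'⟩
      obtain rfl : i = i' := s.injective h
      exact ⟨rfl, h'⟩
  comp_relabel_right t c e d o u := by
    refine LinOrd.ext ?_
    funext ⟨i, j⟩ ⟨i', j'⟩
    refine propext (or_congr Iff.rfl ?_)
    constructor
    · rintro ⟨h, h'⟩
      dsimp only at h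
      subst h
      exact ⟨rfl, h'⟩
    · rintro ⟨h, h'⟩
      obtain rfl : i = i' := h
      exact ⟨rfl, h'⟩
  one_comp o := by
    refine LinOrd.ext ?_
    funext ⟨_, j⟩ ⟨_, j'⟩
    exact propext ⟨by rintro (h | ⟨_, h⟩); exacts [h.elim, h], fun h => Or.inr ⟨rfl, h⟩⟩
  comp_one o := by
    refine LinOrd.ext ?_
    funext ⟨i, _⟩ ⟨i', _⟩
    exact propext ⟨by rintro (h | ⟨_, h⟩); exacts [h, h.elim], fun h => Or.inl h⟩
  assoc o u v := by
    refine LinOrd.ext ?_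
    funext ⟨⟨i, j⟩, k⟩ ⟨⟨i', j'⟩, k'⟩
    apply propext
    constructor
    · rintro ((h | ⟨h, h'⟩) | ⟨h, h'⟩)
      · exact Or.inl h
      · dsimp only at h
        subst h
        exact Or.inr ⟨rfl, Or.inl h'⟩
      · dsimp only at h
        cases h
        exact Or.inr ⟨rfl, Or.inr ⟨rfl, h'⟩⟩
    · rintro (h | ⟨h, h' | ⟨h', h''⟩⟩)
      · exact Or.inl (Or.inl h)
      · obtain rfl : i = i' := h
        exact Or.inl (Or.inr ⟨rfl, h'⟩)
      · obtain rfl : i = i' := h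
        obtain rfl : j = j' := h'
        exact Or.inr ⟨rfl, h''⟩

/-- The operad `M^(0) = M × Ass` of cosimplicial monoids. -/
def monoidPathsOperad : Operad ℕ := pathsOperad.prod (assOperad ℕ)

/-! ### Linking numbers, and the operads `M^(n)` of `n`-commutative cosimplicial monoids -/

/-- `A` and `B` have a shuffling of length `n` that starts with a block of `A`: decompositions
`A = A₁ ∪ ⋯ ∪ A_s` and `B = B₁ ∪ ⋯ ∪ B_t` into nonempty blocks with `A₁ < ⋯ < A_s`,
`B₁ < ⋯ < B_t`, `A₁ ≤ B₁ ≤ A₂ ≤ B₂ ≤ ⋯` and `s + t = n + 1`, the last block of the chain being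
`B_t` (so that `s = t`) or `A_s` (so that `s = t + 1`). -/
def HasShuffling {α : Type} [LinearOrder α] (A B : Set α) (n : ℕ) : Prop :=
  ∃ (s t : ℕ) (P : Fin s → Set α) (Q : Fin t → Set α),
    s + t = n + 1 ∧ (s = t ∨ s = t + 1) ∧
    (⋃ i, P i) = A ∧ (⋃ j, Q j) = B ∧
    (∀ i, (P i).Nonempty) ∧ (∀ j, (Q j).Nonempty) ∧
    (∀ i i', i < i' → ∀ a ∈ P i, ∀ a' ∈ P i', a < a') ∧
    (∀ j j', j < j' → ∀ b ∈ Q j, ∀ b' ∈ Q j', b < b') ∧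
    (∀ i j, i.val ≤ j.val → ∀ a ∈ P i, ∀ b ∈ Q j, a ≤ b) ∧
    (∀ i j, j.val < i.val → ∀ b ∈ Q j, ∀ a ∈ P i, b ≤ a)

/-- The smallest length of a shuffling of `A` and `B` (starting with a block of either set). -/
noncomputable def linkingNumber {α : Type} [LinearOrder α] (A B : Set α) : ℕ :=
  sInf {n | HasShuffling A B n ∨ HasShuffling B A n}

namespace ProductPath

variable {I : Type} {m : ℕ} {c : I → ℕ}

/-- The support of the `i`-th component of a path: the generators `r → r + 1` of `⟨m⟩` that are not
sent to an identity. -/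
def supp (φ : ProductPath m c) (i : I) : Set (Fin m) :=
  {r | φ.1.obj (Interval.of r.val r.isLt.le) i ≠ φ.1.obj (Interval.of (r.val + 1) r.isLt) i}

/-- The linking number of the projection of a path to the coordinates `i` and `j`. -/
noncomputable def lk (φ : ProductPath m c) (i j : I) : ℕ := linkingNumber (φ.supp i) (φ.supp j)

end ProductPath

/-- The relation of `n`-equivalence between operations with two inputs in `M^(0)`: the underlying
paths are equal and have linking number at most `n` (the orders of the inputs are arbitrary). -/
def nEquivalent (n : ℕ) : monoidPathsOperad.Rel := fun I _ _ _ x y =>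
  ∃ s : Fin 2 ≃ I, x.1 = y.1 ∧ ProductPath.lk x.1 (s 0) (s 1) ≤ n

/-- The operad `M^(n)`: `M^(0)` is `M × Ass`, and `M^(n)` for `n ≥ 1` is the quotient of `M^(0)` by
the operadic congruence generated by `n`-equivalence. -/
noncomputable def commOperad : ℕ → Operad ℕ
  | 0 => monoidPathsOperad
  | n + 1 => monoidPathsOperad.quot (nEquivalent (n + 1))

/-- The quotient morphism `q^(n) : M^(0) → M^(n)`. -/
noncomputable def commQuot : ∀ n, Operad.Hom monoidPathsOperad (commOperad n)
  | 0 => Operad.Hom.id _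
  | _ + 1 => Operad.quotMk _ _

/-- The canonical morphism `M^(n) → M^(n + 1)`. -/
noncomputable def commStep : ∀ n, Operad.Hom (commOperad n) (commOperad (n + 1))
  | 0 => Operad.quotMk _ _
  | n + 1 => Operad.quotLift _ _ (Operad.quotMk _ (nEquivalent (n + 2))) (by
      rintro I _ c d x x' ⟨s, h, h'⟩
      exact Quotient.sound (.of ⟨s, h, h'.trans (Nat.le_succ _)⟩))

/-- The canonical morphism `M^(n) → M`. -/
noncomputable def commToPaths : ∀ n, Operad.Hom (commOperad n) pathsOperad
  | 0 => Operad.prodFst _ _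
  | n + 1 => Operad.quotLift _ _ (Operad.prodFst _ _) (by
      rintro I _ c d x x' ⟨s, h, h'⟩
      exact h)

/-! ### Complexity, and the filtration of the lattice path operad -/

section Turns

variable {α β : Type}

open Classical in
/-- The number of changes of direction in a word: the number of pairs of consecutive letters that
are different. -/
noncomputable def turns : List α → ℕ
  | [] => 0
  | [_] => 0
  | a :: b :: l => (if a = b then 0 else 1) + turns (b :: l)

theorem turns_map {f : α → β} (hf : Function.Injective f) (l : List α) :
    turns (l.map f) = turns l := by
  induction l with
  | nil => rfl
  | cons a l ih =>
    cases l with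
    | nil => rfl
    | cons b l =>
      simp only [List.map_cons, turns] at ih ⊢
      rw [ih]
      by_cases hab : a = b
      · simp [hab]
      · simp [hab, hf.eq_iff]

theorem turns_le_turns_map_fst {P : α → Prop} {f : α → β} (hf : ∀ a b, P a → P b → f a = f b → a = b)
    (l : List α) (hl : ∀ a ∈ l, P a) : turns l ≤ turns (l.map f) := by
  induction l with
  | nil => exact le_rfl
  | cons a l ih =>
    cases l with
    | nil => exact le_rfl
    | cons b l =>
      have h1 := ih fun x hx => hl x (List.mem_cons_of_mem _ hx)
      simp only [List.map_cons, turns] at h1 ⊢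
      by_cases hab : a = b
      · subst hab
        simpa using h1
      · have : f a ≠ f b := fun e => hab (hf a b (hl a (by simp)) (hl b (by simp)) e)
        simpa [hab, this] using h1

theorem turns_cons_le (x y : α) (w : List α) : turns (x :: w) ≤ turns (x :: y :: w) := by
  classical
  cases w with
  | nil => simp [turns]
  | cons z w =>
    simp only [turns]
    by_cases h1 : x = z <;> by_cases h2 : x = y <;> by_cases h3 : y = z <;> simp_all <;> omega

theorem turns_replicate_append (x : α) (k : ℕ) (w : List α) :
    turns (List.replicate (k + 1) x ++ w) = turns (x :: w) := by
  induction k with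
  | zero => rfl
  | succ k ih =>
    rw [List.replicate_succ, List.replicate_succ, List.cons_append, List.cons_append, turns,
      ← List.cons_append, ← List.replicate_succ, ih]
    simp

theorem turns_le_cons (x : α) (w : List α) : turns w ≤ turns (x :: w) := by
  cases w with
  | nil => exact le_rfl
  | cons y w => exact Nat.le_add_left _ _

/-- `w` arises from `v` by replacing every letter by some number of copies of it. -/
inductive Blocks : List α → List α → Prop
  | nil : Blocks [] []
  | cons {w v : List α} (k : ℕ) (x : α) : Blocks w v → Blocks (List.replicate k x ++ w) (x :: v)

theorem Blocks.append {w v w' v' : List α} (h : Blocks w v) (h' : Blocks w' v') :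
    Blocks (w ++ w') (v ++ v') := by
  induction h with
  | nil => exact h'
  | cons k x _ ih =>
    rw [List.append_assoc]
    exact .cons k x ih

theorem Blocks.replicate (x : α) (k l : ℕ) (hkl : l = 0 → k = 0) :
    Blocks (List.replicate k x) (List.replicate l x) := by
  induction l generalizing k with
  | zero =>
    rw [hkl rfl]
    exact .nil
  | succ l ih =>
    have h0 : Blocks (List.replicate 0 x) (List.replicate l x) := ih 0 fun _ => rfl
    have := Blocks.cons k x h0
    simpa [List.replicate_succ] using this

theorem Blocks.turns_cons {w v : List α} (h : Blocks w v) (x : α) :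
    turns (x :: w) ≤ turns (x :: v) := by
  induction h generalizing x with
  | nil => exact le_rfl
  | @cons w v k y _ ih =>
    cases k with
    | zero => exact (turns_cons_le x y w).trans (Nat.add_le_add_left (ih y) _)
    | succ k =>
      rw [List.replicate_succ, List.cons_append, turns, turns, ← List.cons_append,
        ← List.replicate_succ, turns_replicate_append]
      exact Nat.add_le_add_left (ih y) _

theorem Blocks.turns {w v : List α} (h : Blocks w v) : turns w ≤ turns v := by
  cases h with
  | nil => exact le_rfl
  | @cons w v k y h =>
    cases k with
    | zero => exact (turns_le_cons y w).trans (h.turns_cons y)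
    | succ k =>
      rw [turns_replicate_append]
      exact h.turns_cons y

end Turns

/-- Two different elements as an embedding. -/
def pairEmb {I : Type} (i j : I) (h : i ≠ j) : Fin 2 ↪ I :=
  ⟨![i, j], by
    intro a b hab
    fin_cases a <;> fin_cases b <;> simp_all⟩

namespace IntervalPath

variable {I : Type} {m : ℕ} {c : I → ℕ}

/-- The number of corners of a lattice path: the number of changes of direction. -/
noncomputable def corners (ψ : IntervalPath m c) : ℕ := turns ψ.word

/-- The complexity index `c_{ij}`: the number of corners of the projection to the coordinates
`i` and `j`. -/
noncomputable def pairComplexity (ψ : IntervalPath m c) (i j : I) (h : i ≠ j) : ℕ :=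
  (ψ.pull (pairEmb i j h)).corners

/-- The complexity index, i.e. the maximum of the `c_{ij}`, is at most `n`. -/
def ComplexityLE (ψ : IntervalPath m c) (n : ℕ) : Prop :=
  ∀ i j (h : i ≠ j), ψ.pairComplexity i j h ≤ n

end IntervalPath

section Complexity

open Classical in
/-- The test whether `k` is one of the two elements `i` and `j`. -/
noncomputable def isPair {α : Type} (i j k : α) : Bool := decide (k = i ∨ k = j)

@[simp] theorem isPair_iff {α : Type} (i j k : α) : isPair i j k = true ↔ k = i ∨ k = j := by
  simp [isPair]

theorem IntervalPath.pairComplexity_eq {I : Type} {m : ℕ} {c : I → ℕ} (ψ : IntervalPath m c)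
    (i j : I) (h : i ≠ j) : ψ.pairComplexity i j h =
      turns (ψ.word.filter (isPair i j)) := by
  classical
  have key := dirs_pull (pairEmb i j h) (ψ.1.map (Interval.total m))
  have h1 := turns_map (pairEmb i j h).injective (ψ.pull (pairEmb i j h)).word
  refine h1.symm.trans ?_
  refine congrArg turns (Eq.trans key ?_)
  refine List.filter_congr fun k _ => ?_
  refine Bool.eq_iff_iff.2 ((@decide_eq_true_iff _ (_)).trans (Iff.trans ?_ (isPair_iff _ _ _).symm))
  constructor
  · rintro ⟨a, rfl⟩
    fin_cases a
    · exact Or.inl rfl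
    · exact Or.inr rfl
  · rintro (rfl | rfl)
    · exact ⟨0, rfl⟩
    · exact ⟨1, rfl⟩

variable {I : Type} {J : I → Type} {c : I → ℕ} {e : ∀ i, J i → ℕ}

theorem filter_dirs_subst_same (ω : ∀ i, Interval (c i) ⥤ Funny (fun j => Interval (e i j)))
    (i : I) (Q : (Σ i, J i) → Bool) (hQ : ∀ q, Q q = true → q.1 = i)
    {x y : Funny (fun i => Interval (c i))} (g : x ⟶ y) (g' : x.pt i ⟶ y.pt i) :
    (dirs (c := fun q : Σ i, J i => e q.1 q.2) ((Funny.subst ω).map g)).filter Q =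
      ((dirs ((ω i).map g')).map (Sigma.mk i)).filter Q := by
  induction g using Funny.hom_induction with
  | hid x =>
    rw [Subsingleton.elim g' (𝟙 _)]
    simp only [CategoryTheory.Functor.map_id, dirs_id, List.map_nil]
  | @hcomp x y z f g hf hg =>
    have f' : x.pt i ⟶ y.pt i := (Funny.toPi _).map f i
    have g1 : y.pt i ⟶ z.pt i := (Funny.toPi _).map g i
    rw [Subsingleton.elim g' (f' ≫ g1), CategoryTheory.Functor.map_comp,
      CategoryTheory.Functor.map_comp, dirs_comp, dirs_comp, List.map_append, List.filter_append,
      List.filter_append, hf f', hg g1]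
  | @hstep x y k f h =>
    rw [dirs_subst_step]
    by_cases hk : k = i
    · subst hk
      rw [Subsingleton.elim f g']
    · rw [dirs_map_congr (ω i) rfl (h i fun e => hk e.symm).symm g' (𝟙 _),
        CategoryTheory.Functor.map_id, dirs_id, List.map_nil, List.filter_nil,
        List.filter_eq_nil_iff]
      intro q hq hq'
      obtain ⟨j, _, rfl⟩ := List.mem_map.1 hq
      exact hk (hQ _ hq')

theorem blocks_dirs_subst (ω : ∀ i, Interval (c i) ⥤ Funny (fun j => Interval (e i j)))
    (q q' : Σ i, J i) {x y : Funny (fun i => Interval (c i))} (g : x ⟶ y) :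
    Blocks (((dirs (c := fun q : Σ i, J i => e q.1 q.2) ((Funny.subst ω).map g)).filter
        (isPair q q')).map Sigma.fst)
      ((dirs g).filter (isPair q.1 q'.1)) := by
  classical
  induction g using Funny.hom_induction with
  | hid x =>
    simp only [CategoryTheory.Functor.map_id, dirs_id, List.filter_nil, List.map_nil]
    exact .nil
  | @hcomp x y z f g hf hg =>
    rw [CategoryTheory.Functor.map_comp, dirs_comp, dirs_comp, List.filter_append, List.map_append,
      List.filter_append]
    exact hf.append hg
  | @hstep x y k f h =>
    rw [dirs_subst_step, dirs_step, List.filter_replicate]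
    set w := ((dirs ((ω k).map f)).map (Sigma.mk k)).filter (isPair q q') with hw
    have hwk : ∀ p ∈ w, p.1 = k ∧ (p = q ∨ p = q') := by
      intro p hp
      obtain ⟨h1, h2⟩ := List.mem_filter.1 hp
      obtain ⟨j, _, rfl⟩ := List.mem_map.1 h1
      exact ⟨rfl, by simpa using h2⟩
    have hrep : w.map Sigma.fst = List.replicate w.length k := by
      rw [List.eq_replicate_iff]
      refine ⟨by simp, fun a ha => ?_⟩
      obtain ⟨p, hp, rfl⟩ := List.mem_map.1 ha
      exact (hwk p hp).1
    rw [hrep]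
    by_cases hk : k = q.1 ∨ k = q'.1
    · rw [if_pos (by simpa using hk)]
      refine Blocks.replicate k _ _ fun h0 => ?_
      have hle := Interval.val_le f
      have : x.pt k = y.pt k := Interval.val_inj.1 (by omega)
      rw [hw, dirs_map_congr (ω k) rfl this.symm f (𝟙 _), CategoryTheory.Functor.map_id, dirs_id]
      rfl
    · rw [if_neg (by simpa using hk)]
      have : w = [] := by
        rw [List.eq_nil_iff_forall_not_mem]
        intro p hp
        obtain ⟨h1, h2 | h2⟩ := hwk p hp
        · exact hk (Or.inl (by rw [← h1, h2]))
        · exact hk (Or.inr (by rw [← h1, h2]))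
      rw [this]
      exact .nil


/-- The number of corners between two inputs of a composite that belong to the same operation. -/
theorem pairComplexity_subst_same {m : ℕ} (ψ : IntervalPath m c)
    (ω : ∀ i, IntervalPath (c i) (e i)) (i : I) (j j' : J i) (h : j ≠ j')
    (h' : (⟨i, j⟩ : Σ i, J i) ≠ ⟨i, j'⟩) :
    (ψ.subst ω).pairComplexity ⟨i, j⟩ ⟨i, j'⟩ h' = (ω i).pairComplexity j j' h := by
  classical
  rw [IntervalPath.pairComplexity_eq, IntervalPath.pairComplexity_eq,
    ← turns_map (sigma_mk_injective (i := i) (β := J))]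
  refine congrArg turns ?_
  have h1 := filter_dirs_subst_same (fun i => (ω i).1) i
    (isPair ⟨i, j⟩ ⟨i, j'⟩) (by
      rintro q hq
      rcases (isPair_iff _ _ _).1 hq with rfl | rfl <;> rfl)
    (ψ.1.map (Interval.total m)) ((Funny.toPi _).map (ψ.1.map (Interval.total m)) i)
  refine h1.trans ?_
  have h2 := dirs_map_congr (ω i).1 (a' := Interval.bot (c i)) (b' := Interval.top (c i))
    (congrArg (fun x => Funny.pt x i) ψ.2.1) (congrArg (fun x => Funny.pt x i) ψ.2.2)
    ((Funny.toPi _).map (ψ.1.map (Interval.total m)) i) (Interval.total (c i))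
  refine (congrArg (fun w => (List.map (Sigma.mk i) w).filter _) h2).trans ?_
  refine List.filter_map.trans ?_
  refine congrArg (List.map _) (List.filter_congr fun k _ => Bool.eq_iff_iff.2 ?_)
  simp

/-- The number of corners between two inputs of a composite that belong to different operations. -/
theorem pairComplexity_subst_le {m : ℕ} (ψ : IntervalPath m c)
    (ω : ∀ i, IntervalPath (c i) (e i)) (q q' : Σ i, J i) (h : q.1 ≠ q'.1) (h' : q ≠ q') :
    (ψ.subst ω).pairComplexity q q' h' ≤ ψ.pairComplexity q.1 q'.1 h := by
  classical
  rw [IntervalPath.pairComplexity_eq, IntervalPath.pairComplexity_eq]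
  refine le_trans ?_ (blocks_dirs_subst (fun i => (ω i).1) q q'
    (ψ.1.map (Interval.total m))).turns
  refine turns_le_turns_map_fst (P := fun p => p = q ∨ p = q') (f := Sigma.fst) ?_
    ((ψ.subst ω).word.filter (isPair q q')) ?_
  · rintro a b (rfl | rfl) (rfl | rfl) hab
    exacts [rfl, (h hab).elim, (h hab.symm).elim, rfl]
  · intro a ha
    simpa using (List.mem_filter.1 ha).2

theorem IntervalPath.ComplexityLE.subst {m n : ℕ} {ψ : IntervalPath m c}
    {ω : ∀ i, IntervalPath (c i) (e i)} (hψ : ψ.ComplexityLE n) (hω : ∀ i, (ω i).ComplexityLE n) :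
    (ψ.subst ω).ComplexityLE n := by
  rintro ⟨i, j⟩ ⟨i', j'⟩ h
  by_cases hi : i = i'
  · subst hi
    have hj : j ≠ j' := fun e => h (by rw [e])
    exact (pairComplexity_subst_same ψ ω i j j' hj h).le.trans (hω i j j' hj)
  · exact (pairComplexity_subst_le ψ ω _ _ hi h).trans (hψ i i' hi)

theorem IntervalPath.ComplexityLE.pull {m n : ℕ} {ψ : IntervalPath m c} (hψ : ψ.ComplexityLE n)
    {K : Type} (s : K ≃ I) : (ψ.pull s.toEmbedding).ComplexityLE n := by
  classical
  intro i j h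
  refine le_trans (le_of_eq ?_) (hψ (s i) (s j) (s.injective.ne h))
  rw [IntervalPath.pairComplexity_eq, IntervalPath.pairComplexity_eq, ← turns_map s.injective]
  refine congrArg turns ?_
  have h1 : (ψ.pull s.toEmbedding).word = ψ.word.map s.symm := dirs_pull_equiv s _
  rw [h1, List.filter_map, List.map_map]
  simp only [Equiv.self_comp_symm, List.map_id]
  refine List.filter_congr fun k _ => Bool.eq_iff_iff.2 ?_
  simp [Equiv.symm_apply_eq]

end Complexity

/-- The suboperad `L^(n)` of the lattice path operad: the operations of complexity at most `n`. -/
noncomputable def latticeFiltration (n : ℕ) : Operad ℕ :=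
  latticePathOperad.sub (fun {_} _ {_} {_} (ψ : IntervalPath _ _) => ψ.ComplexityLE n)
    (fun _ i j h => (h (Subsingleton.elim (α := Unit) i j)).elim)
    (fun _ _ hψ hω => hψ.subst hω)
    (fun s _ _ _ hψ => hψ.pull s)

/-- The inclusion `L^(n) → L^(n + 1)`. -/
noncomputable def latticeStep (n : ℕ) :
    Operad.Hom (latticeFiltration n) (latticeFiltration (n + 1)) where
  app ψ := ⟨ψ.1, fun i j h => (ψ.2 i j h).trans (Nat.le_succ n)⟩
  app_one _ := rfl
  app_comp _ _ := rfl
  app_relabel _ _ _ _ := rfl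

/-- The inclusion `L^(n) → L`. -/
noncomputable def latticeIncl (n : ℕ) : Operad.Hom (latticeFiltration n) latticePathOperad where
  app ψ := ψ.1
  app_one _ := rfl
  app_comp _ _ := rfl
  app_relabel _ _ _ _ := rfl

/-! ### The order of first movements -/

open Classical in
/-- The linear order on the inputs of an operation of `L` by the order of their first movements:
`i` precedes `j` if the path moves in the direction `i` before it moves in the direction `j`. -/
noncomputable def firstMovement {I : Type} {m : ℕ} {c : I → ℕ}
    (ψ : IntervalPath m fun i => c i + 1) : LinOrd I where
  lt i j := ψ.word.idxOf i < ψ.word.idxOf j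
  irrefl _ := lt_irrefl _
  trans _ _ _ := lt_trans
  total i j h := by
    refine lt_or_gt_of_ne fun hij => h ?_
    have hmem : ∀ k, k ∈ ψ.word := by
      intro k
      have hk := count_dirs (ψ.1.map (Interval.total m)) k
      have hb : ((ψ.1.obj (Interval.bot m)).pt k).val = 0 := by
        rw [ψ.2.1]
        rfl
      have ht : ((ψ.1.obj (Interval.top m)).pt k).val = c k + 1 := by
        rw [ψ.2.2]
        rfl
      have h0 : 0 < ψ.word.count k := by
        unfold IntervalPath.word
        omega
      exact List.count_pos_iff.1 h0
    exact (List.idxOf_inj (hmem i)).1 hij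

/-- The map of collections `(p, ϖ) : L → M^(0)`. -/
noncomputable def pathWithOrder {I : Type} [Finite I] {c : I → ℕ} {d : ℕ}
    (ψ : latticePathOperad.Op c d) : monoidPathsOperad.Op c d :=
  (latticeToPaths.app ψ, firstMovement ψ)

end LatticePath

namespace LatticePath

open CategoryTheory

/-! ### Levels: shufflings as monotone labellings -/

/-! The pair of `p` and the first movement order respects units and relabelling, and its first
component respects substitution. Only the order can fail under substitution, and only for inputs
`(i, j)`, `(i', j')` of a composite that come from different operations; the proof measures this
failure.

Project the composite `χ` to `(i, j)` and `(i', j')` and remember only `i` and `i'`. The resulting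
word arises from the projection of `ψ` to `i`, `i'` by replacing each letter by some number of
copies, possibly none (`Blocks`). The order of a pair is read off from the first letter of its
projected word. If the order is reversed, the leading letter has been deleted, and at least one
corner is lost (`Blocks.turns_lt`, `pairComplexity_subst_lt`).

Corners bound linking numbers. Attach to each letter the generator at which the move occurs; the
number of turns made so far then gives monotone even and odd levels on the two supports
(`hasLevels_of_word`). Deleting unoccupied levels yields a shuffling that is no longer
(`HasLevels.exists_hasShuffling`). For disjoint supports, a shuffling conversely bounds the turns,
because each turn strictly raises the level (`HasLevels.turns_le`), so corners and linking number
agree. This gives the second part.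

On `L^(n + 1)` a reversed pair therefore has linking number at most `n`. In `M^(n)` two orders that
differ only on such pairs become equal (`generated_of_lk_le`): one passes from one order to the
other by exchanging adjacent inverted inputs, and each exchange takes place inside a binary
operation of a composite (`generated_swap`). For `n = 0` no pair is reversed, since every pair has
at least one corner. Hence `(p, ϖ)` followed by the quotient morphism is a morphism of operads. -/

theorem turns_le_of_level {α β : Type} (l : List (α × β)) (p : α × β) (n : ℕ) (u : α × β → ℕ)
    (hn : ∀ q ∈ p :: l, u q ≤ n) (hl : (p :: l).Pairwise fun p q => u p ≤ u q ∧
      (p.2 ≠ q.2 → u p < u q)) : u p + turns (p.2 :: l.map Prod.snd) ≤ n := by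
  induction l generalizing p with
  | nil => simpa [turns] using hn p
  | cons q l ih =>
    have h1 := ih q (fun q hq => hn q (List.mem_cons_of_mem _ hq)) (List.pairwise_cons.1 hl).2
    have h2 := (List.pairwise_cons.1 hl).1 q (by simp)
    -- A change of letter contributes one turn and raises the level by at least one; a repetition
    -- contributes nothing and does not lower the level.
    rw [List.map_cons, turns]
    split_ifs with h
    · have := h2.1
      omega
    · have := h2.2 h
      omega

section Levels

variable {α : Type} [LinearOrder α]

/-- A labelling of `A` by even and of `B` by odd levels at most `n`, compatible with the order. In
contrast to a shuffling of length `n`, levels may be missing. -/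
def HasLevels (A B : Set α) (n : ℕ) : Prop :=
  ∃ f g : α → ℕ, (∀ a ∈ A, f a ≤ n ∧ Even (f a)) ∧ (∀ b ∈ B, g b ≤ n ∧ Odd (g b)) ∧
    (∀ a ∈ A, ∀ a' ∈ A, f a < f a' → a < a') ∧ (∀ b ∈ B, ∀ b' ∈ B, g b < g b' → b < b') ∧
    (∀ a ∈ A, ∀ b ∈ B, f a < g b → a ≤ b) ∧ (∀ a ∈ A, ∀ b ∈ B, g b < f a → b ≤ a)

theorem HasLevels.one_le {A B : Set α} {n : ℕ} (h : HasLevels A B n) (hB : B.Nonempty) :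
    1 ≤ n := by
  obtain ⟨f, g, -, hg, -⟩ := h
  obtain ⟨b, hb⟩ := hB
  have := (hg b hb).2.pos
  have := (hg b hb).1
  omega

/-- The `i`-th block of `A` gets the level `2 * i` and the `j`-th block of `B` the level `2 * j +
1`: these are the positions in the alternating chain, counted from zero. -/
theorem HasShuffling.hasLevels {A B : Set α} {n : ℕ} (h : HasShuffling A B n) :
    HasLevels A B n := by
  classical
  obtain ⟨s, t, P, Q, hst, hst', rfl, rfl, -, -, hP, hQ, hPQ, hQP⟩ := h
  have key : ∀ {k : ℕ} (R : Fin k → Set α), ∃ u : α → ℕ, ∀ a ∈ ⋃ i, R i,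
      ∃ i : Fin k, a ∈ R i ∧ u a = i := by
    intro k R
    -- Any block containing the element will do, so disjointness of the blocks is not needed; the
    -- value `0` outside their union is never used.
    refine ⟨fun a => if h : ∃ i, a ∈ R i then (h.choose : Fin k).val else 0, fun a ha => ?_⟩
    have h := Set.mem_iUnion.1 ha
    exact ⟨h.choose, h.choose_spec, dif_pos h⟩
  obtain ⟨u, hu⟩ := key P
  obtain ⟨v, hv⟩ := key Q
  refine ⟨fun a => 2 * u a, fun b => 2 * v b + 1, fun a ha => ?_, fun b hb => ?_,
    fun a ha a' ha' h => ?_, fun b hb b' hb' h => ?_, fun a ha b hb h => ?_, fun a ha b hb h => ?_⟩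
  all_goals beta_reduce at *
  · obtain ⟨i, -, hi⟩ := hu a ha
    exact ⟨by have := i.isLt; omega, even_two_mul _⟩
  · obtain ⟨i, -, hi⟩ := hv b hb
    exact ⟨by have := i.isLt; omega, odd_two_mul_add_one _⟩
  · obtain ⟨i, h1, hi⟩ := hu a ha
    obtain ⟨i', h1', hi'⟩ := hu a' ha'
    exact hP i i' (Fin.lt_def.2 (by omega)) a h1 a' h1'
  · obtain ⟨i, h1, hi⟩ := hv b hb
    obtain ⟨i', h1', hi'⟩ := hv b' hb'
    exact hQ i i' (Fin.lt_def.2 (by omega)) b h1 b' h1'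
  · obtain ⟨i, h1, hi⟩ := hu a ha
    obtain ⟨j, h2, hj⟩ := hv b hb
    exact hPQ i j (by omega) a h1 b h2
  · obtain ⟨i, h1, hi⟩ := hu a ha
    obtain ⟨j, h2, hj⟩ := hv b hb
    exact hQP i j (by omega) b h2 a h1

/-- If a level is missing, then there is a labelling with fewer levels. -/
theorem HasLevels.hasShuffling_or {A B : Set α} {n : ℕ} (h : HasLevels A B n) (hB : B.Nonempty) :
    HasShuffling A B n ∨ ∃ m < n, HasLevels A B m ∨ HasLevels B A m := by
  have hn := h.one_le hB
  obtain ⟨f, g, hf, hg, hff, hgg, hfg, hgf⟩ := h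
  by_cases hsurj : ∀ k ≤ n, (∃ a ∈ A, f a = k) ∨ ∃ b ∈ B, g b = k
  -- If every level is occupied, the level sets are nonempty and serve as the blocks; the two
  -- witnesses count the even and the odd numbers in `0, …, n`.
  · refine Or.inl ⟨n / 2 + 1, (n + 1) / 2, fun i => {a ∈ A | f a = 2 * i.val},
      fun j => {b ∈ B | g b = 2 * j.val + 1}, by omega, by omega, ?_, ?_, fun i => ?_, fun j => ?_,
      ?_, ?_, ?_, ?_⟩
    · ext a
      simp only [Set.mem_iUnion, Set.mem_ofPred_eq, exists_and_left]
      refine ⟨fun h => h.1, fun h => ⟨h, ?_⟩⟩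
      obtain ⟨h1, k, hk⟩ := hf a h
      exact ⟨⟨k, by omega⟩, by dsimp only; omega⟩
    · ext b
      simp only [Set.mem_iUnion, Set.mem_ofPred_eq, exists_and_left]
      refine ⟨fun h => h.1, fun h => ⟨h, ?_⟩⟩
      obtain ⟨h1, k, hk⟩ := hg b h
      exact ⟨⟨k, by omega⟩, hk⟩
    · rcases hsurj (2 * i.val) (by have := i.isLt; omega) with ⟨a, ha, h⟩ | ⟨b, hb, h⟩
      · exact ⟨a, ha, h⟩
      · obtain ⟨k, hk⟩ := (hg b hb).2
        omega
    · rcases hsurj (2 * j.val + 1) (by have := j.isLt; omega) with ⟨a, ha, h⟩ | ⟨b, hb, h⟩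
      · obtain ⟨k, hk⟩ := (hf a ha).2
        omega
      · exact ⟨b, hb, h⟩
    · rintro i i' hi a ⟨ha, h⟩ a' ⟨ha', h'⟩
      have := Fin.lt_def.1 hi
      exact hff a ha a' ha' (by omega)
    · rintro i i' hi b ⟨hb, h⟩ b' ⟨hb', h'⟩
      have := Fin.lt_def.1 hi
      exact hgg b hb b' hb' (by omega)
    · rintro i j hij a ⟨ha, h⟩ b ⟨hb, h'⟩
      exact hfg a ha b hb (by omega)
    · rintro i j hij b ⟨hb, h'⟩ a ⟨ha, h⟩
      exact hgf a ha b hb (by omega)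
  · right
    push Not at hsurj
    obtain ⟨k, hk, hA, hB⟩ := hsurj
    rcases Nat.eq_zero_or_pos k with rfl | hk0
    -- With the bottom level empty, every label that occurs is positive. Lowering all of them by one
    -- changes the parities, so `A` and `B` exchange roles and the chain starts with `B`.
    · refine ⟨n - 1, by omega, Or.inr ⟨fun b => g b - 1, fun a => f a - 1, fun b hb => ?_,
        fun a ha => ?_, fun b hb b' hb' h => hgg b hb b' hb' ?_,
        fun a ha a' ha' h => hff a ha a' ha' ?_,
        fun b hb a ha h => hgf a ha b hb ?_, fun b hb a ha h => hfg a ha b hb ?_⟩⟩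
      all_goals beta_reduce at *
      · obtain ⟨h1, l, hl⟩ := hg b hb
        exact ⟨by omega, l, by omega⟩
      · obtain ⟨h1, l, hl⟩ := hf a ha
        have := hA a ha
        exact ⟨by omega, l - 1, by omega⟩
      all_goals omega
    rcases Nat.eq_or_lt_of_le hk with rfl | hkn
    -- With the top level empty, the same labels already satisfy the smaller bound.
    · refine ⟨k - 1, by omega, Or.inl ⟨f, g, fun a ha => ⟨?_, (hf a ha).2⟩,
        fun b hb => ⟨?_, (hg b hb).2⟩, hff, hgg, hfg, hgf⟩⟩
      · have := hA a ha
        have := (hf a ha).1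
        omega
      · have := hB b hb
        have := (hg b hb).1
        omega
    -- With an inner level `k` empty, the levels `k - 1` and `k + 1` belong to the same set and can
    -- be merged. Lowering everything above `k` by two does this and preserves parity.
    · have par : ∀ l, l ≠ k → ((if k < l then l - 2 else l) + 2 = l ∧ k < l) ∨
          ((if k < l then l - 2 else l) = l ∧ l < k) := by
        intro l hl
        split_ifs <;> omega
      refine ⟨n - 1, by omega, Or.inl ⟨fun a => if k < f a then f a - 2 else f a,
        fun b => if k < g b then g b - 2 else g b, fun a ha => ?_, fun b hb => ?_,
        fun a ha a' ha' h => ?_, fun b hb b' hb' h => ?_, fun a ha b hb h => ?_,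
        fun a ha b hb h => ?_⟩⟩
      all_goals beta_reduce at *
      · obtain ⟨h1, l, hl⟩ := hf a ha
        rcases par _ (hA a ha) with h | h
        · exact ⟨by omega, l - 1, by omega⟩
        · exact ⟨by omega, l, by omega⟩
      · obtain ⟨h1, l, hl⟩ := hg b hb
        rcases par _ (hB b hb) with h | h
        · exact ⟨by omega, l - 1, by omega⟩
        · exact ⟨by omega, l, by omega⟩
      · have h1 := par _ (hA a ha)
        have h2 := par _ (hA a' ha')
        exact hff a ha a' ha' (by omega)
      · have h1 := par _ (hB b hb)
        have h2 := par _ (hB b' hb')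
        exact hgg b hb b' hb' (by omega)
      · have h1 := par _ (hA a ha)
        have h2 := par _ (hB b hb)
        exact hfg a ha b hb (by omega)
      · have h1 := par _ (hA a ha)
        have h2 := par _ (hB b hb)
        exact hgf a ha b hb (by omega)

theorem linkingNumber_comm (A B : Set α) : linkingNumber A B = linkingNumber B A :=
  congrArg sInf (Set.ext fun _ => or_comm)

/-- Empty levels are removed until none is left. The induction must cover both sets symmetrically,
because removing the bottom level exchanges them. -/
theorem HasLevels.exists_hasShuffling {A B : Set α} {n : ℕ} (h : HasLevels A B n)
    (hA : A.Nonempty) (hB : B.Nonempty) :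
    ∃ m ≤ n, HasShuffling A B m ∨ HasShuffling B A m := by
  induction n using Nat.strong_induction_on generalizing A B with
  | _ n ih =>
    rcases h.hasShuffling_or hB with h | ⟨m, hm, h | h⟩
    · exact ⟨n, le_rfl, Or.inl h⟩
    · obtain ⟨l, hl, h⟩ := ih m hm h hA hB
      exact ⟨l, by omega, h⟩
    · obtain ⟨l, hl, h⟩ := ih m hm h hB hA
      exact ⟨l, by omega, h.symm⟩

variable {β : Type}

/-- A word of pairs, weakly increasing in the first components, gives levels for the sets of first
components: the numbers of changes of the second component. -/
theorem hasLevels_of_word (l : List (α × β)) (r : α) {x y : β} (hxy : x ≠ y)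
    (hl : ((r, x) :: l).Pairwise fun p q => p.1 ≤ q.1) (hm : ∀ p ∈ l, p.2 = x ∨ p.2 = y) :
    HasLevels {r' | (r', x) ∈ (r, x) :: l} {r' | (r', y) ∈ (r, x) :: l}
      (turns (x :: l.map Prod.snd)) := by
  classical
  -- The letters `x` and `y` must vary: after a turn the rest of the word starts with `y`, so there
  -- the even levels belong to `y`.
  induction l generalizing r x y with
  | nil =>
    refine ⟨fun _ => 0, fun _ => 0, ?_, ?_, ?_, ?_, ?_, ?_⟩ <;> simp [hxy.symm]
  | cons p l ih =>
    obtain ⟨r1, z⟩ := p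
    have hr : ∀ r' z', (r', z') ∈ (r1, z) :: l → r ≤ r' := fun r' z' h =>
      (List.pairwise_cons.1 hl).1 _ h
    have hl' := (List.pairwise_cons.1 hl).2
    have hm' : ∀ p ∈ l, p.2 = x ∨ p.2 = y := fun p hp => hm p (List.mem_cons_of_mem _ hp)
    have hmem : ∀ r', (r', y) ∈ (r, x) :: (r1, z) :: l ↔ (r', y) ∈ (r1, z) :: l := fun r' => by
      rw [List.mem_cons, Prod.mk.injEq]
      exact or_iff_right fun h => hxy h.2.symm
    have hmem' : ∀ r', (r', x) ∈ (r, x) :: (r1, z) :: l ↔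
        r' = r ∨ (r' ≠ r ∧ (r', x) ∈ (r1, z) :: l) := fun r' => by
      rw [List.mem_cons, Prod.mk.injEq]
      tauto
    rcases hm (r1, z) (by simp) with h | h <;> dsimp only at h <;> subst h
    · obtain ⟨f, g, hf, hg, hff, hgg, hfg, hgf⟩ := ih r1 hxy hl' hm'
      have ht : turns (z :: ((r1, z) :: l).map Prod.snd) = turns (z :: l.map Prod.snd) := by
        simp [turns]
      rw [ht]
      simp only [Set.mem_ofPred_eq] at hf hg hff hgg hfg hgf
      -- No turn occurs, so the old levels are kept. If `r` occurs again later with the same letter,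
      -- its level is reset to `0`; this is harmless because `r` is the least first component.
      refine ⟨Function.update f r 0, g, ?_, ?_, ?_, ?_, ?_, ?_⟩ <;>
        simp only [Set.mem_ofPred_eq, hmem, hmem']
      · rintro a (rfl | ⟨h, ha⟩)
        · simp
        · simpa [h] using hf a ha
      · exact hg
      · rintro a (rfl | ⟨h, ha⟩) a' (rfl | ⟨h', ha'⟩)
        · simp
        · exact fun _ => lt_of_le_of_ne (hr _ _ ha') h'.symm
        · simp
        · simpa [h, h'] using hff a ha a' ha'
      · exact hgg
      · rintro a (rfl | ⟨h, ha⟩) b hb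
        · exact fun _ => hr _ _ hb
        · simpa [h] using hfg a ha b hb
      · rintro a (rfl | ⟨h, ha⟩) b hb
        · simp
        · simpa [h] using hgf a ha b hb
    · obtain ⟨f, g, hf, hg, hff, hgg, hfg, hgf⟩ := ih r1 hxy.symm hl' fun p hp => (hm' p hp).symm
      have ht : turns (x :: ((r1, z) :: l).map Prod.snd) = turns (z :: l.map Prod.snd) + 1 := by
        simp [turns, hxy, add_comm]
      rw [ht]
      simp only [Set.mem_ofPred_eq] at hf hg hff hgg hfg hgf
      -- At a turn the roles of the two labellings are exchanged and all levels move up by one,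
      -- which makes room for `r` at level `0`.
      refine ⟨Function.update (fun r => g r + 1) r 0, fun r => f r + 1, ?_, ?_, ?_, ?_, ?_, ?_⟩ <;>
        simp only [Set.mem_ofPred_eq, hmem, hmem']
      · rintro a (rfl | ⟨h, ha⟩)
        · simp
        · simpa [h] using ⟨(hg a ha).1, (hg a ha).2.add_one⟩
      · exact fun b hb => ⟨Nat.succ_le_succ (hf b hb).1, (hf b hb).2.add_one⟩
      · rintro a (rfl | ⟨h, ha⟩) a' (rfl | ⟨h', ha'⟩)
        · simp
        · exact fun _ => lt_of_le_of_ne (hr _ _ ha') h'.symm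
        · simp
        · simpa [h, h'] using hgg a ha a' ha'
      · exact fun b hb b' hb' h => hff b hb b' hb' (Nat.lt_of_succ_lt_succ h)
      · rintro a (rfl | ⟨h, ha⟩) b hb
        · exact fun _ => hr _ _ hb
        · simpa [h] using hgf b hb a ha
      · rintro a (rfl | ⟨h, ha⟩) b hb
        · simp
        · simpa [h] using hfg b hb a ha

/-- A word of pairs, weakly increasing in the first components, has at most `n` changes of the
second component if the first components have `n` levels and determine the second ones. -/
theorem HasLevels.turns_le {A B : Set α} {n : ℕ} (h : HasLevels A B n) (hAB : Disjoint A B)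
    {x y : β} (l : List (α × β)) (hl : l.Pairwise fun p q => p.1 ≤ q.1)
    (hm : ∀ p ∈ l, (p.2 = x ∧ p.1 ∈ A) ∨ (p.2 = y ∧ p.1 ∈ B)) :
    turns (l.map Prod.snd) ≤ n := by
  classical
  obtain ⟨f, g, hf, hg, hff, hgg, hfg, hgf⟩ := h
  have hdis : ∀ a ∈ A, a ∉ B := fun a ha hb => Set.disjoint_left.1 hAB ha hb
  cases l with
  | nil => exact Nat.zero_le _
  | cons p l =>
    -- Disjointness merges the two labellings into a single level function of the generator.
    refine (Nat.le_add_left _ _).trans (turns_le_of_level l p n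
      (fun q => if q.1 ∈ A then f q.1 else g q.1) (fun q hq => ?_) (hl.imp_of_mem ?_))
    · rcases hm q hq with ⟨-, h⟩ | ⟨-, h⟩
      · simpa [h] using (hf _ h).1
      · have h' : q.1 ∉ A := fun h' => hdis _ h' h
        simpa [h'] using (hg _ h).1
    · rintro ⟨r, z⟩ ⟨r', z'⟩ hp hq hle
      dsimp only at hle
      rcases hm _ hp with ⟨h1, h2⟩ | ⟨h1, h2⟩ <;> rcases hm _ hq with ⟨h3, h4⟩ | ⟨h3, h4⟩ <;>
        dsimp only at h1 h2 h3 h4 ⊢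
      · rw [if_pos h2, if_pos h4]
        exact ⟨not_lt.1 fun h => (hff _ h4 _ h2 h).not_ge hle, fun h => (h (h1.trans h3.symm)).elim⟩
      · have h5 : r' ∉ A := fun h => hdis _ h h4
        have h6 : r ≠ r' := fun e => h5 (e ▸ h2)
        rw [if_pos h2, if_neg h5]
        -- For different letters the generators are distinct by disjointness, so the levels cannot
        -- be in the wrong order. Their parities differ, so they are not equal either, and the level
        -- rises strictly.
        have h7 : ¬ g r' < f r := fun h => h6 (le_antisymm hle (hgf _ h2 _ h4 h))
        obtain ⟨k, hk⟩ := (hf _ h2).2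
        obtain ⟨k', hk'⟩ := (hg _ h4).2
        exact ⟨by omega, fun _ => by omega⟩
      · have h5 : r ∉ A := fun h => hdis _ h h2
        have h6 : r ≠ r' := fun e => h5 (e ▸ h4)
        rw [if_neg h5, if_pos h4]
        have h7 : ¬ f r' < g r := fun h => h6 (le_antisymm hle (hfg _ h4 _ h2 h))
        obtain ⟨k, hk⟩ := (hg _ h2).2
        obtain ⟨k', hk'⟩ := (hf _ h4).2
        exact ⟨by omega, fun _ => by omega⟩
      · rw [if_neg fun h => hdis _ h h2, if_neg fun h => hdis _ h h4]
        exact ⟨not_lt.1 fun h => (hgg _ h4 _ h2 h).not_ge hle, fun h => (h (h1.trans h3.symm)).elim⟩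

end Levels

/-! ### Words of lattice paths, and linking numbers -/

/-! ### First letters of projected words -/

section FirstLetters

variable {α : Type}

open Classical in
-- Deleting all other letters does not affect which of the two comes first. No membership hypothesis
-- is needed, since the index of an absent letter is the length of the word.
theorem idxOf_lt_idxOf_iff {x y : α} (hxy : x ≠ y) (w : List α) :
    w.idxOf x < w.idxOf y ↔ (w.filter (isPair x y)).head? = some x := by
  induction w with
  | nil => simp
  | cons z w ih =>
    by_cases hx : z = x
    · subst hx
      simp [hxy]
    · by_cases hy : z = y
      · subst hy
        simp [hxy.symm]
      · simp [hx, hy, ih]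

theorem isPair_comm (x y : α) : isPair x y = isPair y x := by
  funext z
  exact Bool.eq_iff_iff.2 (by simp [or_comm])

/-- The block of the leading `x` must be empty, for otherwise `w` would start with `x`. Putting that
`x` back in front of `w` still gives at most as many turns as `v` has, and it creates one new turn
before `y`. -/
theorem Blocks.turns_lt {w v : List α} (h : Blocks w v) {x y : α} (hxy : x ≠ y)
    (hw : w.head? = some y) (hv : v.head? = some x) :
    LatticePath.turns w < LatticePath.turns v := by
  cases h with
  | nil => simp at hw
  | @cons w v k z h =>
    obtain rfl : z = x := by simpa using hv
    cases k with
    | zero =>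
      have h1 := h.turns_cons z
      cases w with
      | nil => simp at hw
      | cons u w =>
        obtain rfl : u = y := by simpa using hw
        simp only [LatticePath.turns, if_neg hxy] at h1
        simp only [List.replicate_zero, List.nil_append]
        omega
    | succ k => exact (hxy (by simpa [List.replicate_succ] using hw)).elim

end FirstLetters

/-! ### Corners, supports and linking numbers -/

section Linking

variable {I : Type} {m : ℕ} {c : I → ℕ}

theorem IntervalPath.firstMovement_lt_iff {c : I → ℕ} (ψ : IntervalPath m fun i => c i + 1)
    {i j : I} (h : i ≠ j) :
    (firstMovement ψ).lt i j ↔ (ψ.word.filter (isPair i j)).head? = some i :=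
  idxOf_lt_idxOf_iff h ψ.word

/-- A coordinate changes across a generator by the number of occurrences of its letter in the
corresponding word. This links the supports, which depend only on `p(ψ)`, to the words. -/
theorem IntervalPath.mem_supp_iff (ψ : IntervalPath m c) (r : Fin m) (i : I) :
    r ∈ ψ.toProduct.supp i ↔ i ∈ dirs (ψ.1.map (Interval.hom (a := Interval.of r.val r.isLt.le)
      (b := Interval.of (r.val + 1) r.isLt) (Nat.le_succ r.val))) := by
  classical
  have h := count_dirs (ψ.1.map (Interval.hom (a := Interval.of r.val r.isLt.le)
      (b := Interval.of (r.val + 1) r.isLt) (Nat.le_succ r.val))) i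
  rw [← List.count_pos_iff]
  change (ψ.1.obj _).pt i ≠ (ψ.1.obj _).pt i ↔ _
  rw [Ne, ← Interval.val_inj]
  omega

/-- The word of a path, each letter being equipped with the generator at which the move occurs. -/
theorem IntervalPath.exists_labelled_word (ψ : IntervalPath m c) :
    ∃ l : List (Fin m × I), l.map Prod.snd = ψ.word ∧ l.Pairwise (fun p q => p.1 ≤ q.1) ∧
      ∀ r i, (r, i) ∈ l ↔ r ∈ ψ.toProduct.supp i := by
  -- The word is built along the initial segments `0 → k`: passing to `k + 1` appends the word of
  -- the generator `k → k + 1`, with all its letters labelled by that generator.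
  have key : ∀ k (hk : k ≤ m), ∃ l : List (Fin m × I),
      l.map Prod.snd = dirs (ψ.1.map (Interval.hom (a := Interval.bot m) (b := Interval.of k hk)
        (Nat.zero_le k))) ∧ l.Pairwise (fun p q => p.1 ≤ q.1) ∧
      ∀ r i, (r, i) ∈ l ↔ r.val < k ∧ r ∈ ψ.toProduct.supp i := by
    intro k
    induction k with
    | zero =>
      intro hk
      refine ⟨[], ?_, .nil, by simp⟩
      refine Eq.symm ((dirs_map_congr ψ.1 rfl ?_ _ (𝟙 (Interval.bot m))).trans ?_)
      · rfl
      · rw [CategoryTheory.Functor.map_id, dirs_id]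
        rfl
    | succ k ih =>
      intro hk
      obtain ⟨l, h1, h2, h3⟩ := ih (Nat.le_of_succ_le hk)
      let r : Fin m := ⟨k, hk⟩
      let s := dirs (ψ.1.map (Interval.hom (a := Interval.of r.val r.isLt.le)
        (b := Interval.of (r.val + 1) r.isLt) (Nat.le_succ r.val)))
      refine ⟨l ++ s.map fun i => (r, i), ?_, ?_, ?_⟩
      · rw [List.map_append, h1, List.map_map]
        refine (congrArg (_ ++ ·) (List.map_id s)).trans ?_
        rw [← dirs_comp, ← CategoryTheory.Functor.map_comp]
        rfl
      · rw [List.pairwise_append]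
        refine ⟨h2, ?_, ?_⟩
        · rw [List.pairwise_map]
          exact List.pairwise_of_forall fun _ _ => le_rfl
        · rintro ⟨r', i⟩ hp q hq
          obtain ⟨j, _, rfl⟩ := List.mem_map.1 hq
          exact Fin.le_def.2 ((h3 _ _).1 hp).1.le
      · intro r' i
        rw [List.mem_append, h3]
        have h4 : (r', i) ∈ s.map (fun i => (r, i)) ↔ r' = r ∧ r' ∈ ψ.toProduct.supp i := by
          rw [List.mem_map]
          constructor
          · rintro ⟨j, hj, h⟩
            obtain ⟨rfl, rfl⟩ := Prod.mk.inj h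
            exact ⟨rfl, (ψ.mem_supp_iff _ _).2 hj⟩
          · rintro ⟨rfl, h⟩
            exact ⟨i, (ψ.mem_supp_iff _ _).1 h, rfl⟩
        rw [h4, Fin.ext_iff]
        change _ ∨ (r'.val = k ∧ _) ↔ _
        rw [Nat.lt_succ_iff_lt_or_eq]
        tauto
  obtain ⟨l, h1, h2, h3⟩ := key m le_rfl
  exact ⟨l, h1, h2, fun r i => (h3 r i).trans (and_iff_right r.isLt)⟩

/-- The word of the projection of a path to two coordinates, with the generators. -/
theorem IntervalPath.exists_labelled_pair (ψ : IntervalPath m c) (i j : I) :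
    ∃ l : List (Fin m × I), l.map Prod.snd = ψ.word.filter (isPair i j) ∧
      l.Pairwise (fun p q => p.1 ≤ q.1) ∧
      (∀ p ∈ l, (p.2 = i ∧ p.1 ∈ ψ.toProduct.supp i) ∨ (p.2 = j ∧ p.1 ∈ ψ.toProduct.supp j)) ∧
      (∀ r, (r, i) ∈ l ↔ r ∈ ψ.toProduct.supp i) ∧ ∀ r, (r, j) ∈ l ↔ r ∈ ψ.toProduct.supp j := by
  obtain ⟨l, h1, h2, h3⟩ := ψ.exists_labelled_word
  refine ⟨l.filter fun p => isPair i j p.2, ?_, h2.filter _, ?_, ?_, ?_⟩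
  · rw [← h1, List.filter_map]
    rfl
  · rintro ⟨r, k⟩ h
    obtain ⟨hl, h'⟩ := List.mem_filter.1 h
    rcases (isPair_iff _ _ _).1 h' with h' | h' <;> dsimp only at h' <;> subst h'
    · exact Or.inl ⟨rfl, (h3 _ _).1 hl⟩
    · exact Or.inr ⟨rfl, (h3 _ _).1 hl⟩
  · intro r
    simp [List.mem_filter, h3]
  · intro r
    simp [List.mem_filter, h3]

/-- The target intervals have positive length `c i + 1`, so a path between the distinguished objects
moves in every direction. -/
theorem IntervalPath.supp_nonempty {c : I → ℕ} (ψ : IntervalPath m fun i => c i + 1) (i : I) :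
    (ψ.toProduct.supp i).Nonempty := by
  classical
  obtain ⟨l, h1, -, h3⟩ := ψ.exists_labelled_word
  have h := count_dirs (ψ.1.map (Interval.total m)) i
  have hb : ((ψ.1.obj (Interval.bot m)).pt i).val = 0 := by
    rw [ψ.2.1]
    rfl
  have ht : ((ψ.1.obj (Interval.top m)).pt i).val = c i + 1 := by
    rw [ψ.2.2]
    rfl
  have h0 : i ∈ ψ.word := List.count_pos_iff.1 (by
    unfold IntervalPath.word
    omega)
  rw [← h1, List.mem_map] at h0
  obtain ⟨⟨r, k⟩, hp, rfl⟩ := h0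
  exact ⟨r, (h3 _ _).1 hp⟩

/-- The first letter of the projected word decides which support carries the even levels. -/
theorem IntervalPath.hasLevels {c : I → ℕ} (ψ : IntervalPath m fun i => c i + 1) (i j : I)
    (h : i ≠ j) :
    HasLevels (ψ.toProduct.supp i) (ψ.toProduct.supp j) (ψ.pairComplexity i j h) ∨
      HasLevels (ψ.toProduct.supp j) (ψ.toProduct.supp i) (ψ.pairComplexity i j h) := by
  obtain ⟨l, h1, h2, h3, h4, h5⟩ := ψ.exists_labelled_pair i j
  rw [ψ.pairComplexity_eq, ← h1]
  have hi : ψ.toProduct.supp i = {r | (r, i) ∈ l} := Set.ext fun r => (h4 r).symm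
  have hj : ψ.toProduct.supp j = {r | (r, j) ∈ l} := Set.ext fun r => (h5 r).symm
  rw [hi, hj]
  cases l with
  | nil =>
    obtain ⟨r, hr⟩ := ψ.supp_nonempty i
    exact absurd ((h4 r).2 hr) (by simp)
  | cons p l =>
    obtain ⟨r, k⟩ := p
    have hm : ∀ p ∈ l, p.2 = i ∨ p.2 = j := fun p hp =>
      (h3 p (List.mem_cons_of_mem _ hp)).imp And.left And.left
    rcases h3 _ List.mem_cons_self with ⟨rfl, -⟩ | ⟨rfl, -⟩
    · exact Or.inl (hasLevels_of_word l r h h2 hm)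
    · exact Or.inr (hasLevels_of_word l r h.symm h2 fun p hp => (hm p hp).symm)

/-- Both directions occur in the projection, so it has a corner. This rules out reversed pairs in
`L^(1)`, where no identification of orders is available. -/
theorem IntervalPath.one_le_pairComplexity {c : I → ℕ} (ψ : IntervalPath m fun i => c i + 1)
    (i j : I) (h : i ≠ j) : 1 ≤ ψ.pairComplexity i j h := by
  rcases ψ.hasLevels i j h with h' | h'
  · exact h'.one_le (ψ.supp_nonempty j)
  · exact h'.one_le (ψ.supp_nonempty i)

/-- Besides bounding the linking number, this shows that the infimum defining it is taken over a
nonempty set. -/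
theorem IntervalPath.exists_hasShuffling {c : I → ℕ} (ψ : IntervalPath m fun i => c i + 1)
    (i j : I) (h : i ≠ j) : ∃ n ≤ ψ.pairComplexity i j h,
      HasShuffling (ψ.toProduct.supp i) (ψ.toProduct.supp j) n ∨
        HasShuffling (ψ.toProduct.supp j) (ψ.toProduct.supp i) n := by
  rcases ψ.hasLevels i j h with h' | h'
  · exact h'.exists_hasShuffling (ψ.supp_nonempty i) (ψ.supp_nonempty j)
  · obtain ⟨n, hn, hn'⟩ := h'.exists_hasShuffling (ψ.supp_nonempty j) (ψ.supp_nonempty i)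
    exact ⟨n, hn, hn'.symm⟩

/-- The linking number is at most the number of corners. -/
theorem IntervalPath.lk_le_pairComplexity {c : I → ℕ} (ψ : IntervalPath m fun i => c i + 1)
    (i j : I) (h : i ≠ j) : ψ.toProduct.lk i j ≤ ψ.pairComplexity i j h := by
  obtain ⟨n, hn, hn'⟩ := ψ.exists_hasShuffling i j h
  exact (Nat.sInf_le hn').trans hn

/-- For disjoint supports, the linking number is the number of corners. -/
theorem IntervalPath.pairComplexity_le_lk {c : I → ℕ} (ψ : IntervalPath m fun i => c i + 1)
    (i j : I) (h : i ≠ j) (hd : Disjoint (ψ.toProduct.supp i) (ψ.toProduct.supp j)) :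
    ψ.pairComplexity i j h ≤ ψ.toProduct.lk i j := by
  obtain ⟨n, -, hn⟩ := ψ.exists_hasShuffling i j h
  obtain ⟨l, h1, h2, h3, -, -⟩ := ψ.exists_labelled_pair i j
  rw [ψ.pairComplexity_eq, ← h1]
  -- A lower bound for the infimum needs an actual shuffling, because the infimum of the empty set
  -- of natural numbers is `0`.
  refine le_csInf ⟨n, hn⟩ ?_
  rintro k (hk | hk)
  · exact hk.hasLevels.turns_le hd l h2 h3
  · exact hk.hasLevels.turns_le hd.symm l h2 fun p hp => (h3 p hp).symm

theorem ProductPath.lk_comm (φ : ProductPath m c) (i j : I) : φ.lk i j = φ.lk j i :=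
  linkingNumber_comm _ _

variable {J : I → Type} {e : ∀ i, J i → ℕ}

/-- If substitution reverses the order of first movements, then it decreases the number of
corners. -/
theorem pairComplexity_subst_lt {c : I → ℕ} (ψ : IntervalPath m fun i => c i + 1)
    (ω : ∀ i, IntervalPath (c i + 1) (fun j => e i j + 1)) {i i' : I} (h : i ≠ i')
    (j : J i) (j' : J i') (h' : (⟨i, j⟩ : Σ i, J i) ≠ ⟨i', j'⟩) (hψ : (firstMovement ψ).lt i i')
    (hχ : (firstMovement (c := fun q : Σ i, J i => e q.1 q.2) (ψ.subst ω)).lt ⟨i', j'⟩ ⟨i, j⟩) :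
    (ψ.subst ω).pairComplexity ⟨i, j⟩ ⟨i', j'⟩ h' < ψ.pairComplexity i i' h := by
  have h1 := (ψ.firstMovement_lt_iff h).1 hψ
  have h2 := (IntervalPath.firstMovement_lt_iff (c := fun q : Σ i, J i => e q.1 q.2) (ψ.subst ω)
    h'.symm).1 hχ
  rw [isPair_comm] at h2
  rw [IntervalPath.pairComplexity_eq, IntervalPath.pairComplexity_eq]
  have h3 := blocks_dirs_subst (fun i => (ω i).1) ⟨i, j⟩ ⟨i', j'⟩ (ψ.1.map (Interval.total m))
  -- Passing from `(i, j)`, `(i', j')` to `i`, `i'` loses no turns, as `i ≠ i'`. The new word starts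
  -- with `i'` while that of `ψ` starts with `i`, so the strict estimate applies.
  refine lt_of_le_of_lt ?_ (h3.turns_lt h (y := i') ?_ h1)
  · refine turns_le_turns_map_fst (P := fun p => p = ⟨i, j⟩ ∨ p = ⟨i', j'⟩) (f := Sigma.fst) ?_
      ((ψ.subst ω).word.filter (isPair ⟨i, j⟩ ⟨i', j'⟩)) ?_
    · rintro a b (rfl | rfl) (rfl | rfl) hab
      exacts [rfl, (h hab).elim, (h hab.symm).elim, rfl]
    · intro a ha
      simpa using (List.mem_filter.1 ha).2
  · rw [List.head?_map]
    exact congrArg (Option.map Sigma.fst) h2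

theorem lk_subst_lt {c : I → ℕ} (ψ : IntervalPath m fun i => c i + 1)
    (ω : ∀ i, IntervalPath (c i + 1) (fun j => e i j + 1)) {i i' : I} (h : i ≠ i')
    (j : J i) (j' : J i') (hψ : (firstMovement ψ).lt i i')
    (hχ : (firstMovement (c := fun q : Σ i, J i => e q.1 q.2) (ψ.subst ω)).lt ⟨i', j'⟩ ⟨i, j⟩) :
    (ψ.subst ω).toProduct.lk ⟨i, j⟩ ⟨i', j'⟩ < ψ.pairComplexity i i' h :=
  (IntervalPath.lk_le_pairComplexity (c := fun q : Σ i, J i => e q.1 q.2) (ψ.subst ω) ⟨i, j⟩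
    ⟨i', j'⟩ fun e => h (congrArg Sigma.fst e)).trans_lt
      (pairComplexity_subst_lt ψ ω h j j' _ hψ hχ)

/-- Between inputs of the same operation, the order of first movements in a composite is that of
the operation. -/
theorem firstMovement_subst_same {c : I → ℕ} (ψ : IntervalPath m fun i => c i + 1)
    (ω : ∀ i, IntervalPath (c i + 1) (fun j => e i j + 1)) (i : I) {j j' : J i} (h : j ≠ j') :
    (firstMovement (c := fun q : Σ i, J i => e q.1 q.2) (ψ.subst ω)).lt ⟨i, j⟩ ⟨i, j'⟩ ↔
      (firstMovement (ω i)).lt j j' := by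
  have h' : (⟨i, j⟩ : Σ i, J i) ≠ ⟨i, j'⟩ := fun e => h (sigma_mk_injective e)
  rw [IntervalPath.firstMovement_lt_iff (c := fun q : Σ i, J i => e q.1 q.2) _ h',
    IntervalPath.firstMovement_lt_iff _ h]
  have h1 := filter_dirs_subst_same (fun i => (ω i).1) i (isPair ⟨i, j⟩ ⟨i, j'⟩) (by
      rintro q hq
      rcases (isPair_iff _ _ _).1 hq with rfl | rfl <;> rfl)
    (ψ.1.map (Interval.total m)) ((Funny.toPi _).map (ψ.1.map (Interval.total m)) i)
  have h2 := dirs_map_congr (ω i).1 (a' := Interval.bot (c i + 1)) (b' := Interval.top (c i + 1))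
    (congrArg (fun x => Funny.pt x i) ψ.2.1) (congrArg (fun x => Funny.pt x i) ψ.2.2)
    ((Funny.toPi _).map (ψ.1.map (Interval.total m)) i) (Interval.total (c i + 1))
  -- The `i`-th component of `ψ` runs from the initial to the terminal object. However `ψ`
  -- interleaves it with the other directions, the letters of the row `i` therefore spell the full
  -- word of `ω i`.
  have h3 : (ψ.subst ω).word.filter (isPair ⟨i, j⟩ ⟨i, j'⟩) =
      ((ω i).word.filter (isPair j j')).map (Sigma.mk i) := by
    refine h1.trans ((congrArg (fun w => (List.map (Sigma.mk i) w).filter _) h2).trans ?_)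
    refine List.filter_map.trans ?_
    refine congrArg (List.map _) (List.filter_congr fun k _ => Bool.eq_iff_iff.2 ?_)
    simp
  rw [h3, List.head?_map]
  refine ⟨fun h => ?_, fun h => by rw [h]; rfl⟩
  obtain ⟨k, hk, hk'⟩ := Option.map_eq_some_iff.1 h
  rw [hk, sigma_mk_injective hk']

end Linking

/-! ### Changing the order of the inputs in `M^(n)` -/

section Reorder

/-! ### Linear orders: inversions and adjacent exchanges -/

namespace LinOrd

variable {I : Type}

theorem asymm (σ : LinOrd I) {i j : I} (h : σ.lt i j) : ¬ σ.lt j i := fun h' =>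
  σ.irrefl _ (σ.trans _ _ _ h h')

theorem ne (σ : LinOrd I) {i j : I} (h : σ.lt i j) : i ≠ j := fun e => by
  subst e
  exact σ.irrefl _ h

/-- By totality, a linear order cannot be properly contained in another one. -/
theorem eq_of_imp {σ σ' : LinOrd I} (h : ∀ i j, σ.lt i j → σ'.lt i j) : σ = σ' := by
  refine LinOrd.ext (funext fun i => funext fun j => propext ⟨h i j, fun h' => ?_⟩)
  exact (σ.total i j (σ'.ne h')).resolve_right fun h'' => σ'.asymm h' (h _ _ h'')

/-- The order induced along an injective map. -/
def comap {J : Type} (f : J → I) (hf : Function.Injective f) (σ : LinOrd I) : LinOrd J where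
  lt i j := σ.lt (f i) (f j)
  irrefl _ := σ.irrefl _
  trans _ _ _ := σ.trans _ _ _
  total _ _ h := σ.total _ _ (hf.ne h)

/-- Exchanges two adjacent elements. -/
def swap (σ : LinOrd I) (a b : I) (hab : σ.lt a b) (h : ∀ k, σ.lt a k → ¬ σ.lt k b) :
    LinOrd I where
  lt i j := (i = b ∧ j = a) ∨ (σ.lt i j ∧ ¬ (i = a ∧ j = b))
  irrefl i := by
    rintro (⟨h1, h2⟩ | h1)
    · exact σ.ne hab (h2.symm.trans h1)
    · exact σ.irrefl _ h1.1
  trans i j k := by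
    have hne := σ.ne hab
    rintro (⟨rfl, rfl⟩ | ⟨h1, h2⟩) (⟨h3, rfl⟩ | ⟨h3, h4⟩)
    · exact (hne h3).elim
    · have hk : k ≠ i := fun e => h4 ⟨rfl, e⟩
      -- Adjacency enters here: an element above the lower member of the exchanged pair, and
      -- different from the upper one, lies above both.
      refine Or.inr ⟨(σ.total i k hk.symm).resolve_right (h k h3), fun e => hne e.1.symm⟩
    · subst h3
      have hi : i ≠ k := fun e => h2 ⟨e, rfl⟩
      refine Or.inr ⟨(σ.total i k hi).resolve_right fun h5 => h i h5 h1, fun e => hne e.2⟩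
    · refine Or.inr ⟨σ.trans _ _ _ h1 h3, ?_⟩
      rintro ⟨rfl, rfl⟩
      exact h j h1 h3
  total i j hij := by
    by_cases h1 : i = a ∧ j = b
    · exact Or.inr (Or.inl h1.symm)
    by_cases h2 : i = b ∧ j = a
    · exact Or.inl (Or.inl h2)
    · exact (σ.total i j hij).imp (fun h => Or.inr ⟨h, h1⟩)
        fun h => Or.inr ⟨h, fun e => h2 e.symm⟩

/-- Two different orders differ on a pair that is adjacent in the first order. -/
theorem exists_adjacent [Finite I] {σ σ' : LinOrd I} (h : σ ≠ σ') :
    ∃ a b, σ.lt a b ∧ σ'.lt b a ∧ ∀ k, σ.lt a k → ¬ σ.lt k b := by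
  -- Induction on the number of elements between `a` and `b`. If `k` lies between them, then `σ'`
  -- inverts `(a, k)` or `(k, b)`, since it puts `b` before `a`; either pair has fewer elements in
  -- between.
  have key : ∀ n a b, Set.ncard {k | σ.lt a k ∧ σ.lt k b} = n → σ.lt a b → σ'.lt b a →
      ∃ a b, σ.lt a b ∧ σ'.lt b a ∧ ∀ k, σ.lt a k → ¬ σ.lt k b := by
    intro n
    induction n using Nat.strong_induction_on with
    | _ n ih =>
      intro a b hn hab hab'
      by_cases hk : ∃ k, σ.lt a k ∧ σ.lt k b
      · obtain ⟨k, h1, h2⟩ := hk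
        have hlt : ∀ s : Set I, s ⊆ {k | σ.lt a k ∧ σ.lt k b} → k ∉ s → s.ncard < n := by
          intro s hs hks
          rw [← hn]
          exact Set.ncard_lt_ncard ((Set.ssubset_iff_of_subset hs).2 ⟨k, ⟨h1, h2⟩, hks⟩)
            (Set.toFinite _)
        rcases σ'.total k a (σ.ne h1).symm with h3 | h3
        · exact ih _ (hlt _ (fun x hx => ⟨hx.1, σ.trans _ _ _ hx.2 h2⟩)
            fun hx => σ.irrefl _ hx.2) a k rfl h1 h3
        · exact ih _ (hlt _ (fun x hx => ⟨σ.trans _ _ _ h1 hx.1, hx.2⟩)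
            fun hx => σ.irrefl _ hx.1) k b rfl h2 (σ'.trans _ _ _ hab' h3)
      · exact ⟨a, b, hab, hab', fun k h1 h2 => hk ⟨k, h1, h2⟩⟩
  by_contra h0
  refine h (eq_of_imp fun i j hij => ?_)
  exact (σ'.total i j (σ.ne hij)).resolve_right fun h1 => h0 (key _ i j rfl hij h1)

end LinOrd

/-! ### Identifying orders in the quotient operads -/

variable {I : Type} [Finite I] {c : I → ℕ} {d : ℕ}

/-- The diagonal path. -/
def ProductPath.diagonal (K : Type) (m : ℕ) : ProductPath m (fun _ : K => m) :=
  ⟨CategoryTheory.Functor.pi' fun _ => 𝟭 _, rfl, rfl⟩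

/-- An operation of `M × Ass` is a composite of its restrictions to the fibres of a map of the
inputs, provided that the order is lexicographic. -/
theorem monoidPaths_eq_comp {K : Type} [Finite K] (f : I → K) (φ : pathsOperad.Op c d)
    (σ : LinOrd I) (τ : LinOrd K)
    (h : ∀ i j, σ.lt i j ↔ τ.lt (f i) (f j) ∨ (f i = f j ∧ σ.lt i j)) :
    ((φ, σ) : monoidPathsOperad.Op c d) =
      monoidPathsOperad.relabel (Equiv.sigmaFiberEquiv f).symm
        (monoidPathsOperad.comp (I := K) (J := fun k => {i // f i = k}) (c := fun _ => d)
          (e := fun _ i => c i.1)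
          ((ProductPath.diagonal K (d + 1), τ) : monoidPathsOperad.Op (fun _ : K => d) d)
          fun k => ((ProductPath.pull (Subtype.val : {i // f i = k} → I) φ,
            σ.comap Subtype.val Subtype.val_injective) :
              monoidPathsOperad.Op (fun i : {i // f i = k} => c i.1) d)) := by
  refine Prod.ext (ProductPath.ext fun _ => rfl) (LinOrd.ext ?_)
  funext i j
  refine propext ((h i j).trans (or_congr Iff.rfl ?_))
  -- Transport between fibres does not change the underlying input, so the order inside a fibre is
  -- the restriction of `σ`.
  have key : ∀ k (hk : f i = k) (y : {l // f l = k}), σ.lt i y.1 ↔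
      (σ.comap (Subtype.val : {l // f l = k} → I) Subtype.val_injective).lt
        (hk ▸ (⟨i, rfl⟩ : {l // f l = f i})) y := by
    rintro _ rfl y
    rfl
  exact ⟨fun ⟨h1, h2⟩ => ⟨h1, (key _ h1 ⟨j, rfl⟩).1 h2⟩,
    fun ⟨h1, h2⟩ => ⟨h1, (key _ h1 ⟨j, rfl⟩).2 h2⟩⟩

/-- Exchanging two adjacent inputs of linking number at most `n` is an `n`-equivalence. -/
theorem generated_swap (φ : pathsOperad.Op c d) (σ : LinOrd I) (a b : I) (hab : σ.lt a b)
    (h : ∀ k, σ.lt a k → ¬ σ.lt k b) {n : ℕ} (hn : ProductPath.lk φ a b ≤ n) :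
    Operad.Generated monoidPathsOperad (nEquivalent n) (φ, σ) (φ, σ.swap a b hab h) := by
  classical
  have hne := σ.ne hab
  -- Collapse `b` onto `a`. As the two are adjacent, both `σ` and the exchanged order are
  -- lexicographic over this quotient with the same order `τ`, and they differ only inside the fibre
  -- `{a, b}`.
  let f : I → {k // k ≠ b} := fun i => if hi : i = b then ⟨a, hne⟩ else ⟨i, hi⟩
  have hfb : f b = ⟨a, hne⟩ := dif_pos rfl
  have hf : ∀ i (hi : i ≠ b), f i = ⟨i, hi⟩ := fun i hi => dif_neg hi
  have hfa : f a = ⟨a, hne⟩ := hf a hne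
  let τ : LinOrd {k // k ≠ b} := σ.comap Subtype.val Subtype.val_injective
  -- A criterion that applies to both orders: `ρ` agrees with `σ` away from `b`, and `a` and `b`
  -- compare in the same way with every other input.
  have hτ : ∀ ρ : LinOrd I, (∀ i j, i ≠ b → j ≠ b → (ρ.lt i j ↔ σ.lt i j)) →
      (∀ k, k ≠ a → k ≠ b → (ρ.lt a k ↔ ρ.lt b k) ∧ (ρ.lt k a ↔ ρ.lt k b)) →
      ∀ i j, ρ.lt i j ↔ τ.lt (f i) (f j) ∨ (f i = f j ∧ ρ.lt i j) := by
    intro ρ h1 h2 i j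
    have h3 : τ.lt (f i) (f j) ↔ ρ.lt (f i).1 (f j).1 := (h1 _ _ (f i).2 (f j).2).symm
    rw [h3]
    by_cases hi : i = b <;> by_cases hj : j = b
    · subst hi hj
      simp [ρ.irrefl]
    · subst hi
      rw [hfb, hf j hj, Subtype.mk.injEq]
      by_cases hja : j = a
      · subst hja
        simp [ρ.irrefl]
      · rw [(h2 j hja hj).1]
        simp [Ne.symm hja]
    · subst hj
      rw [hfb, hf i hi, Subtype.mk.injEq]
      by_cases hia : i = a
      · subst hia
        simp [ρ.irrefl]
      · rw [(h2 i hia hi).2]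
        simp [hia]
    · rw [hf i hi, hf j hj]
      tauto
  have hadj : ∀ k, k ≠ a → k ≠ b → (σ.lt a k ↔ σ.lt b k) ∧ (σ.lt k a ↔ σ.lt k b) :=
    fun k hka hkb => ⟨⟨fun h1 => (σ.total b k hkb.symm).resolve_right (h k h1),
      σ.trans _ _ _ hab⟩, ⟨fun h1 => σ.trans _ _ _ h1 hab,
      fun h1 => (σ.total k a hka).resolve_right fun h2 => h k h2 h1⟩⟩
  have hswap : ∀ i j, ¬ (i = a ∧ j = b) → ¬ (i = b ∧ j = a) →
      ((σ.swap a b hab h).lt i j ↔ σ.lt i j) := fun i j h1 h2 => by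
    exact ⟨fun h3 => h3.elim (fun e => (h2 e).elim) And.left, fun h3 => Or.inr ⟨h3, h1⟩⟩
  rw [monoidPaths_eq_comp f φ σ τ (hτ σ (fun _ _ _ _ => Iff.rfl) hadj),
    monoidPaths_eq_comp f φ (σ.swap a b hab h) τ (hτ _
      (fun i j hi hj => hswap i j (fun e => hj e.2) fun e => hi e.1) fun k hka hkb => by
        rw [hswap a k (fun e => hkb e.2) (fun e => hka e.2),
          hswap b k (fun e => hkb e.2) (fun e => hka e.2),
          hswap k a (fun e => hka e.1) (fun e => hkb e.1),
          hswap k b (fun e => hka e.1) (fun e => hkb e.1)]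
        exact hadj k hka hkb)]
  refine .relabel _ (.comp (.refl _) fun k => ?_)
  -- The fibre over `a` carries a binary operation whose linking number is that of `a` and `b` in
  -- `φ`, so a generating relation applies. Every other fibre is a singleton, on which the two
  -- orders coincide.
  by_cases hk : k = ⟨a, hne⟩
  · subst hk
    refine .of ⟨Equiv.ofBijective ![⟨a, hfa⟩, ⟨b, hfb⟩] ⟨?_, ?_⟩, rfl, hn⟩
    · intro x y hxy
      fin_cases x <;> fin_cases y
      exacts [rfl, (hne (congrArg Subtype.val hxy)).elim, (hne (congrArg Subtype.val hxy).symm).elim,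
        rfl]
    · rintro ⟨i, hi⟩
      by_cases hib : i = b
      · exact ⟨1, Subtype.ext hib.symm⟩
      · exact ⟨0, Subtype.ext (congrArg Subtype.val ((hf i hib).symm.trans hi)).symm⟩
  · have hsub : ∀ x : {i // f i = k}, x.1 = k.1 := by
      rintro ⟨i, rfl⟩
      by_cases hib : i = b
      · subst hib
        exact (hk hfb).elim
      · exact (congrArg Subtype.val (hf i hib)).symm
    rw [LinOrd.eq_of_imp (σ := σ.comap (Subtype.val : {i // f i = k} → I) Subtype.val_injective)
      (σ' := (σ.swap a b hab h).comap (Subtype.val : {i // f i = k} → I) Subtype.val_injective)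
      fun x y hxy => (σ.ne hxy ((hsub x).trans (hsub y).symm)).elim]
    exact .refl _

/-- Two orders of the inputs become equal in `M^(n)` if they differ only on pairs of linking number
at most `n`. -/
theorem generated_of_lk_le (φ : pathsOperad.Op c d) {n : ℕ} (σ σ' : LinOrd I)
    (h : ∀ a b, σ.lt a b → σ'.lt b a → ProductPath.lk φ a b ≤ n) :
    Operad.Generated monoidPathsOperad (nEquivalent n) (φ, σ) (φ, σ') := by
  -- Induction on the number of inversions between the two orders.
  generalize hN : Set.ncard {p : I × I | σ.lt p.1 p.2 ∧ σ'.lt p.2 p.1} = N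
  induction N using Nat.strong_induction_on generalizing σ with
  | _ N ih =>
    by_cases hσ : σ = σ'
    · subst hσ
      exact .refl _
    obtain ⟨a, b, hab, hab', hk⟩ := LinOrd.exists_adjacent hσ
    have hsub : ∀ i j, (σ.swap a b hab hk).lt i j → σ'.lt j i →
        σ.lt i j ∧ ¬ (i = a ∧ j = b) := by
      rintro i j (⟨rfl, rfl⟩ | h1) h2
      · exact (σ'.asymm hab' h2).elim
      · exact h1
    -- Exchanging an adjacent inverted pair removes that inversion and creates none, so the
    -- hypothesis on linking numbers persists for the remaining ones.
    refine .trans (generated_swap φ σ a b hab hk (h a b hab hab')) (ih _ ?_ _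
      (fun i j h1 h2 => h i j (hsub i j h1 h2).1 h2) rfl)
    have hss : {p : I × I | (σ.swap a b hab hk).lt p.1 p.2 ∧ σ'.lt p.2 p.1} ⊆
        {p : I × I | σ.lt p.1 p.2 ∧ σ'.lt p.2 p.1} :=
      fun p hp => ⟨(hsub _ _ hp.1 hp.2).1, hp.2⟩
    rw [← hN]
    refine Set.ncard_lt_ncard ((Set.ssubset_iff_of_subset hss).2
      ⟨(a, b), ⟨hab, hab'⟩, fun hp => ?_⟩) (Set.toFinite _)
    exact (hsub _ _ hp.1 hp.2).2 ⟨rfl, rfl⟩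

/-- The condition `1 ≤ n` makes the case `n = 0` uniform with the others: there the quotient
morphism is the identity, so inversions must be excluded altogether. -/
theorem commQuot_eq (n : ℕ) (x x' : monoidPathsOperad.Op c d) (hx : x.1 = x'.1)
    (h : ∀ a b, LinOrd.lt x.2 a b → LinOrd.lt x'.2 b a → 1 ≤ n ∧ ProductPath.lk x.1 a b ≤ n) :
    (commQuot n).app x = (commQuot n).app x' := by
  obtain ⟨φ, σ⟩ := x
  obtain ⟨_, σ'⟩ := x'
  obtain rfl : φ = _ := hx
  cases n with
  | zero =>
    have : σ = σ' := LinOrd.eq_of_imp fun i j hij =>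
      (σ'.total i j (LinOrd.ne σ hij)).resolve_right fun h' => absurd (h i j hij h').1 (by simp)
    rw [this]
  | succ n => exact Quotient.sound (generated_of_lk_le φ σ σ' fun a b h1 h2 => (h a b h1 h2).2)

end Reorder

/-! ### The morphisms `L^(n + 1) → M^(n)` -/

section Morphism

theorem pathWithOrder_one (d : ℕ) :
    pathWithOrder (latticePathOperad.one d) = monoidPathsOperad.one d :=
  Prod.ext (latticeToPaths.app_one d) (LinOrd.eq_of_imp fun _ _ h =>
    (((firstMovement (c := fun _ : Unit => d) (latticePathOperad.one d)).ne h) rfl).elim)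

theorem pathWithOrder_relabel {I J : Type} [Finite I] [Finite J] (s : J ≃ I) {c : I → ℕ} {d : ℕ}
    (ψ : latticePathOperad.Op c d) : pathWithOrder (latticePathOperad.relabel s ψ) =
      monoidPathsOperad.relabel s (pathWithOrder ψ) := by
  classical
  refine Prod.ext (latticeToPaths.app_relabel s ψ) (LinOrd.ext ?_)
  funext i j
  have h1 : (IntervalPath.pull s.toEmbedding ψ).word = (IntervalPath.word ψ).map s.symm :=
    dirs_pull_equiv s _
  have h2 : ∀ (w : List I) (k : J), (w.map s.symm).idxOf k = w.idxOf (s k) := by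
    intro w k
    induction w with
    | nil => rfl
    | cons a w ih =>
      rw [List.map_cons, List.idxOf_cons, List.idxOf_cons, ih]
      by_cases h : a = s k
      · have h' : s.symm a = k := (s.symm_apply_eq).2 h
        rw [h', h, beq_self_eq_true, beq_self_eq_true]
      · have h' : s.symm a ≠ k := fun e => h ((s.symm_apply_eq).1 e)
        rw [beq_false_of_ne h, beq_false_of_ne h']
  refine propext ?_
  change (IntervalPath.pull s.toEmbedding ψ).word.idxOf i <
    (IntervalPath.pull s.toEmbedding ψ).word.idxOf j ↔
      (IntervalPath.word ψ).idxOf (s i) < (IntervalPath.word ψ).idxOf (s j)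
  rw [h1]
  convert Iff.rfl using 2 <;> convert (h2 _ _).symm

/-- On `L^(n + 1)`, the map of collections `(p, ϖ)` is compatible with substitution up to
`n`-equivalence. -/
theorem commQuot_pathWithOrder_comp (n : ℕ) {I : Type} [Finite I] {J : I → Type}
    [∀ i, Finite (J i)] {c : I → ℕ} {e : ∀ i, J i → ℕ} {d : ℕ} (ψ : latticePathOperad.Op c d)
    (ω : ∀ i, latticePathOperad.Op (e i) (c i))
    (hψ : IntervalPath.ComplexityLE ψ (n + 1)) :
    (commQuot n).app (pathWithOrder (latticePathOperad.comp ψ ω)) =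
      (commQuot n).app (monoidPathsOperad.comp (pathWithOrder ψ) fun i => pathWithOrder (ω i)) := by
  refine commQuot_eq n _ _ (latticeToPaths.app_comp ψ ω) ?_
  -- An inversion in the lexicographic composite comes either from the order of `ψ` or, for `i =
  -- i'`, from the order of a single `ω i`.
  rintro ⟨i, j⟩ ⟨i', j'⟩ h1 (h2 | ⟨h2, h3⟩)
  -- Here substitution reverses `i'` and `i`, so `1 ≤ c(χ) < c(ψ) ≤ n + 1`. This gives `1 ≤ n`, and
  -- the linking number, being less than `c(ψ)`, is at most `n`.
  · have hne : i' ≠ i := (firstMovement (c := c) ψ).ne h2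
    have h3 := lk_subst_lt (c := c) ψ ω hne j' j h2 h1
    have h4 := pairComplexity_subst_lt (c := c) ψ ω hne j' j
      (fun e => hne (congrArg Sigma.fst e)) h2 h1
    have h5 := IntervalPath.one_le_pairComplexity (c := fun q : Σ i, J i => e q.1 q.2)
      (IntervalPath.subst ψ ω) ⟨i', j'⟩ ⟨i, j⟩ fun e => hne (congrArg Sigma.fst e)
    have h6 := hψ i' i hne
    exact ⟨by omega, (ProductPath.lk_comm _ _ _).trans_le (Nat.le_of_lt_succ (h3.trans_le h6))⟩
  -- Inputs of one operation keep their order under substitution, so this case is contradictory.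
  · dsimp only at h2
    subst h2
    have hj : j ≠ j' := fun hj =>
      (firstMovement (c := fun q : Σ i, J i => e q.1 q.2) (IntervalPath.subst ψ ω)).ne h1
        (congrArg (Sigma.mk i') hj)
    exact ((firstMovement (c := e i') (ω i')).asymm h3
      ((firstMovement_subst_same (c := c) ψ ω i' hj).1 h1)).elim

/-- The morphism `L^(n + 1) → M^(n)` induced by `p` and the order of first movements. -/
noncomputable def latticeToComm (n : ℕ) :
    Operad.Hom (latticeFiltration (n + 1)) (commOperad n) where
  app ψ := (commQuot n).app (pathWithOrder ψ.1)
  app_one d := (congrArg (commQuot n).app (pathWithOrder_one d)).trans ((commQuot n).app_one d)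
  app_comp ψ ω := (commQuot_pathWithOrder_comp n ψ.1 (fun i => (ω i).1) ψ.2).trans
    ((commQuot n).app_comp _ _)
  app_relabel s _ _ ψ := (congrArg (commQuot n).app (pathWithOrder_relabel s ψ.1)).trans
    ((commQuot n).app_relabel s _)

theorem commStep_commQuot (n : ℕ) {I : Type} [Finite I] {c : I → ℕ} {d : ℕ}
    (x : monoidPathsOperad.Op c d) :
    (commStep n).app ((commQuot n).app x) = (commQuot (n + 1)).app x := by
  cases n <;> rfl

theorem commToPaths_commQuot (n : ℕ) {I : Type} [Finite I] {c : I → ℕ} {d : ℕ}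
    (x : monoidPathsOperad.Op c d) : (commToPaths n).app ((commQuot n).app x) = x.1 := by
  cases n <;> rfl

end Morphism

end LatticePath

/-! ### The main theorem -/

theorem mainTheorem3 :
    -- the morphisms `p^(n + 1) : L^(n + 1) → M^(n)`, for `n ≥ 0`
    (∃ p : ∀ n : ℕ, LatticePath.Operad.Hom (LatticePath.latticeFiltration (n + 1))
        (LatticePath.commOperad n),
      -- they are compatible with the filtrations
      (∀ n, (LatticePath.latticeStep (n + 1)).trans (p (n + 1)) =
        (p n).trans (LatticePath.commStep n)) ∧
      -- they are compatible with `p : L → M`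
      (∀ n, (LatticePath.latticeIncl (n + 1)).trans LatticePath.latticeToPaths =
        (p n).trans (LatticePath.commToPaths n)) ∧
      -- they are induced by `p` and the first movement order
      (∀ (n : ℕ) (I : Type) [Finite I] (c : I → ℕ) (d : ℕ)
        (ψ : (LatticePath.latticeFiltration (n + 1)).Op c d),
        (p n).app ψ = (LatticePath.commQuot n).app
          (LatticePath.pathWithOrder ((LatticePath.latticeIncl (n + 1)).app ψ)))) ∧
    -- if substitution reverses the first movement order of a pair, then the linking number drops
    (∀ (I : Type) [Finite I] (J : I → Type) [∀ i, Finite (J i)] (c : I → ℕ) (e : ∀ i, J i → ℕ)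
      (d : ℕ) (ψ : LatticePath.IntervalPath (d + 1) (fun i => c i + 1))
      (ω : ∀ i, LatticePath.IntervalPath (c i + 1) (fun j => e i j + 1))
      (i i' : I) (h : i ≠ i') (j : J i) (j' : J i'),
      (LatticePath.firstMovement ψ).lt i i' →
      (LatticePath.firstMovement (c := fun q : Σ i, J i => e q.1 q.2) (ψ.subst ω)).lt
        ⟨i', j'⟩ ⟨i, j⟩ →
      (ψ.subst ω).pairComplexity ⟨i, j⟩ ⟨i', j'⟩ (fun hq => h (congrArg Sigma.fst hq)) <
          ψ.pairComplexity i i' h ∧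
        (ψ.subst ω).toProduct.lk ⟨i, j⟩ ⟨i', j'⟩ < ψ.pairComplexity i i' h ∧
        (Disjoint (ψ.toProduct.supp i) (ψ.toProduct.supp i') →
          (ψ.subst ω).toProduct.lk ⟨i, j⟩ ⟨i', j'⟩ < ψ.toProduct.lk i i')) := by
  refine ⟨⟨LatticePath.latticeToComm, fun n => ?_, fun n => ?_, fun _ _ _ _ _ _ => rfl⟩, ?_⟩
  -- Every value of the morphism is the image of `(p, ϖ)` under the quotient morphism, so both
  -- squares reduce to the compatibility of the canonical morphisms with the quotient morphisms.
  · apply LatticePath.Operad.Hom.ext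
    funext I _ c d ψ
    exact (LatticePath.commStep_commQuot n (I := I) (c := c) (d := d)
      (LatticePath.pathWithOrder ψ.1)).symm
  · apply LatticePath.Operad.Hom.ext
    funext I _ c d ψ
    exact (LatticePath.commToPaths_commQuot n (I := I) (c := c) (d := d)
      (LatticePath.pathWithOrder ψ.1)).symm
  · intro I _ J _ c e d ψ ω i i' h j j' h1 h2
    have h3 := LatticePath.lk_subst_lt ψ ω h j j' h1 h2
    exact ⟨LatticePath.pairComplexity_subst_lt ψ ω h j j' _ h1 h2, h3,
      -- For disjoint supports the number of corners of `ψ` is bounded by its linking number, which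
      -- may then replace it on the right.
      fun hd => h3.trans_le (ψ.pairComplexity_le_lk i i' h hd)⟩
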